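/- Let $\Bbbk$ be a field, let $\tau\in\Bbbk$ be such that $x^2+\tau$ is irreducible over $\Bbbk$, let $\mathbb F=\Bbbk[x]/(x^2+\tau)$ with $\xi$ the class of $x$, and let $n\ge 2$. Every $Z\in M_n(\mathbb F)$ is uniquely $Z=A+\xi B$ with $A,B\in M_n(\Bbbk)$. Put $$\mathcal S_1=\{A+\xi B\in \mathrm{GL}_n(\mathbb F): A,\ A+\tau BA^{-1}B\in \mathrm{GL}_n(\Bbbk)\},\qquad \mathcal S_2=\{A+\xi B\in \mathrm{GL}_n(\mathbb F): B,\ \tau B+AB^{-1}A\in \mathrm{GL}_n(\Bbbk)\}.$$ A straight-line program is a finite sequence of instructions whose operands are the inputs $A,B$ or results of earlier instructions. The instructions are: a scalar matrix $cI_n$, a scalar multiple $cX$ ($c\in\Bbbk$), a sum $X+Y$, a product $XY$, and an inverse $X^{-1}$ in $M_n(\Bbbk)$, the last being defined only if $X\in\mathrm{GL}_n(\Bbbk)$; two of the matrices at hand (inputs or results) are its outputs. It inverts a set $\mathcal S\subseteq \mathrm{GL}_n(\mathbb F)$ if for every $Z=A+\xi B\in\mathcal S$ all its instructions are defined on the input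 $(A,B)$ and its outputs are the $C,D\in M_n(\Bbbk)$ with $Z^{-1}=C+\xi D$. Sums, products and inverses are counted; scalar matrices and scalar multiples are free. Frobenius inversion takes $Z=A+\xi B\in\mathcal S_1\cup\mathcal S_2$ and sets $(X,Y,\tau_1,\tau_2)=(A,B,1,\tau)$ if $Z\in\mathcal S_1$, and $(X,Y,\tau_1,\tau_2)=(B,A,\tau,1)$ otherwise. It computes $X^{-1}$, $X^{-1}Y$, $YX^{-1}Y$, $\tau_1X+\tau_2YX^{-1}Y$, $J=(\tau_1X+\tau_2YX^{-1}Y)^{-1}$ and $K=X^{-1}YJ$, and returns $J-\xi K$ in the first case and $K-\xi J$ in the second. Then Frobenius inversion returns $Z^{-1}$ for every $Z\in\mathcal S_1\cup\mathcal S_2$; its first branch is a straight-line program that inverts $\mathcal S_1$ and its second branch is one that inverts $\mathcal S_2$; and each branch uses exactly two inversions, three multiplications and one addition in $M_n(\Bbbk)$. Moreover, it is optimal: every straight-line program that inverts $\mathcal S_1$, and every one that inverts $\mathcal S_2$ (in particular every one that inverts $\mathcal S_1\cup\mathcal S_2$), uses at least five multiplications and inversions in total, and at least one addition. -/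

import Mathlib

open Polynomial

noncomputable section

namespace Frobenius

/-! ### Straight-line programs over a `k`-algebra -/

/-- An instruction of a straight-line program with scalars in `k`. The natural numbers are the
indices of registers that hold the inputs and the results of earlier instructions. Constants mean
scalar multiples of the identity. -/
inductive Instr (k : Type*) where
  | const (c : k)
  | smul (c : k) (i : ℕ)
  | add (i j : ℕ)
  | mul (i j : ℕ)
  | inv (i : ℕ)

/-- `I.Yields s x`: executed on the list `s` of registers, the instruction `I` is defined and its
result is `x`. An inversion is defined exactly when its operand is invertible in `R`. -/
def Instr.Yields {k R : Type*} [Field k] [Ring R] [Algebra k R] : Instr k → List R → R → Prop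
  | .const c, _, x => x = algebraMap k R c
  | .smul c i, s, x => ∃ y, s[i]? = some y ∧ x = c • y
  | .add i j, s, x => ∃ y z, s[i]? = some y ∧ s[j]? = some z ∧ x = y + z
  | .mul i j, s, x => ∃ y z, s[i]? = some y ∧ s[j]? = some z ∧ x = y * z
  | .inv i, s, x => ∃ y, s[i]? = some y ∧ y * x = 1 ∧ x * y = 1

/-- `Exec L s t`: starting from the registers `s`, all instructions of `L` are defined when they
are executed in order, each appending its result as a new register, and the final list of
registers is `t`. -/
def Exec {k R : Type*} [Field k] [Ring R] [Algebra k R] : List (Instr k) → List R → List R → Prop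
  | [], s, t => t = s
  | I :: L, s, t => ∃ x, I.Yields s x ∧ Exec L (s ++ [x]) t

/-- A straight-line program with two inputs (registers `0` and `1`) and two outputs. -/
structure Program (k : Type*) where
  code : List (Instr k)
  out₀ : ℕ
  out₁ : ℕ

/-- On the input `(a, b)` the program is defined and its output is `(c, d)`. -/
def Program.Computes {k R : Type*} [Field k] [Ring R] [Algebra k R] (Γ : Program k)
    (a b c d : R) : Prop :=
  ∃ t : List R, Exec Γ.code [a, b] t ∧ t[Γ.out₀]? = some c ∧ t[Γ.out₁]? = some d

def Instr.isMul {k : Type*} : Instr k → Bool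
  | .mul _ _ => true
  | _ => false

def Instr.isInv {k : Type*} : Instr k → Bool
  | .inv _ => true
  | _ => false

def Instr.isAdd {k : Type*} : Instr k → Bool
  | .add _ _ => true
  | _ => false

/-- Number of multiplications (multiplications by scalars of `k` are not counted). -/
def Program.muls {k : Type*} (Γ : Program k) : ℕ := Γ.code.countP Instr.isMul

/-- Number of inversions. -/
def Program.invs {k : Type*} (Γ : Program k) : ℕ := Γ.code.countP Instr.isInv

/-- Number of additions. -/
def Program.adds {k : Type*} (Γ : Program k) : ℕ := Γ.code.countP Instr.isAdd

/-! ### The quadratic extension and the domains of inversion -/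

/-- `F = k[x]/(x² + τ)`. -/
abbrev QuadExt {k : Type*} [Field k] (τ : k) : Type _ := AdjoinRoot (X ^ 2 + C τ : k[X])

/-- The matrix `A + ξ B` over `F = k[x]/(x² + τ)`, where `ξ` is the class of `x`. -/
def complexify {k : Type*} [Field k] (τ : k) {n : ℕ} (A B : Matrix (Fin n) (Fin n) k) :
    Matrix (Fin n) (Fin n) (QuadExt τ) :=
  A.map (AdjoinRoot.of (X ^ 2 + C τ : k[X])) +
    AdjoinRoot.root (X ^ 2 + C τ : k[X]) • B.map (AdjoinRoot.of (X ^ 2 + C τ : k[X]))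

/-- `S₁ = {A + ξ B ∈ GL_n(F) : A, A + τ B A⁻¹ B ∈ GL_n(k)}`. -/
def S₁ {k : Type*} [Field k] (τ : k) (n : ℕ) : Set (Matrix (Fin n) (Fin n) (QuadExt τ)) :=
  {Z | ∃ A B : Matrix (Fin n) (Fin n) k, Z = complexify τ A B ∧ IsUnit Z ∧
    IsUnit A ∧ IsUnit (A + τ • (B * A⁻¹ * B))}

/-- `S₂ = {A + ξ B ∈ GL_n(F) : B, τ B + A B⁻¹ A ∈ GL_n(k)}`. -/
def S₂ {k : Type*} [Field k] (τ : k) (n : ℕ) : Set (Matrix (Fin n) (Fin n) (QuadExt τ)) :=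
  {Z | ∃ A B : Matrix (Fin n) (Fin n) k, Z = complexify τ A B ∧ IsUnit Z ∧
    IsUnit B ∧ IsUnit (τ • B + A * B⁻¹ * A)}

/-- The program `Γ`, run over `M_n(k)` on the two `k`-components `A`, `B` of `Z = A + ξ B`, is
defined and outputs the two `k`-components of `Z⁻¹`. -/
def Program.InvertsAt {k : Type*} [Field k] {τ : k} {n : ℕ} (Γ : Program k)
    (Z : Matrix (Fin n) (Fin n) (QuadExt τ)) : Prop :=
  ∃ A B U V : Matrix (Fin n) (Fin n) k,
    Z = complexify τ A B ∧ Z⁻¹ = complexify τ U V ∧ Γ.Computes A B U V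

/-- `Γ` inverts every member of `S`. -/
def Program.InvertsOn {k : Type*} [Field k] {τ : k} {n : ℕ} (Γ : Program k)
    (S : Set (Matrix (Fin n) (Fin n) (QuadExt τ))) : Prop :=
  ∀ Z ∈ S, Γ.InvertsAt Z

/-! ### Frobenius inversion -/

/-- The common body of the two branches of Frobenius inversion. Here `X`, `Y` are the registers
`x`, `y`, and the last instruction changes the sign of register `r`. -/
def frobeniusCode {k : Type*} [Field k] (x y : ℕ) (τ₁ τ₂ : k) (r : ℕ) : List (Instr k) :=
  [ .inv x,       -- 2 : X⁻¹
    .mul 2 y,     -- 3 : X⁻¹ Y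
    .mul y 3,     -- 4 : Y X⁻¹ Y
    .smul τ₁ x,   -- 5 : τ₁ X
    .smul τ₂ 4,   -- 6 : τ₂ Y X⁻¹ Y
    .add 5 6,     -- 7 : τ₁ X + τ₂ Y X⁻¹ Y
    .inv 7,       -- 8 : J = (τ₁ X + τ₂ Y X⁻¹ Y)⁻¹
    .mul 3 8,     -- 9 : K = X⁻¹ Y J
    .smul (-1) r ]

/-- The branch for `S₁`: `X = A`, `Y = B`, `τ₁ = 1`, `τ₂ = τ`, and the output is `J - ξ K`. -/
def frobenius₁ {k : Type*} [Field k] (τ : k) : Program k := ⟨frobeniusCode 0 1 1 τ 9, 8, 10⟩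

/-- The branch for `S₂`: `X = B`, `Y = A`, `τ₁ = τ`, `τ₂ = 1`, and the output is `K - ξ J`. -/
def frobenius₂ {k : Type*} [Field k] (τ : k) : Program k := ⟨frobeniusCode 1 0 τ 1 8, 9, 10⟩

open Classical in
/-- Frobenius inversion: the straight-line program that is run on the input `Z`. -/
def frobeniusInversion {k : Type*} [Field k] (τ : k) {n : ℕ}
    (Z : Matrix (Fin n) (Fin n) (QuadExt τ)) : Program k :=
  if Z ∈ S₁ τ n then frobenius₁ τ else frobenius₂ τ

end Frobenius

end

/-! Correctness is a direct check that (A + ξB)(C + ξD) = 1. For the lower bounds a program is run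
on all inputs from `S₁` at once, so that registers become functions on `Pt` with pointwise
operations. `S₂` reduces to `S₁`: multiplication by ξ turns (A, B) into (-τB, A), which merely swaps
and rescales inputs and outputs.

Multiplications and inversions: all registers lie in a span that starts as span{1, A, B} and gains
one generator per counted instruction. If four sufficed, eliminating the last generator between the
outputs C and D would put a nontrivial αC + βD into the third span
(`exists_linear_combination_mem`). `false_of_three_steps` refutes this on two families of commuting
inputs, (a, M) with a nonzero scalar a, and (M, sM). Products of polynomials in M stay polynomials
in M, whereas αC + βD is (αa - βx)/(a² + τx²) at x = M on the first family and (α - βs)/((1 + τs²)x)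
on the second. Since M may have any suitable quadratic factor in its minimal polynomial, identities
in M of low degree lift to k[x] (`eq_zero_of_rep_scalar`, `eq_zero_of_rep_proportional`). Moreover a
polynomial of degree at most 2 that represents an invertible register is c or c(a² + τx²) on the
first family and a monomial on the second.

Consequently an inverse adjoined in the first two steps is constant along the first family. If there
is one, the second span has degree at most 2 there; otherwise it has degree at most 4 on the second
family. A third product gives polynomials only, and a third inverse is excluded by letting a or s
vary.

Addition: without it, every register vanishes at (1, 0) or takes equal values at (1, 0) and (1, 1);
the output C does neither. -/

namespace Frobenius

variable {k : Type*} [Field k] {τ : k} {n : ℕ}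

/-! ### Arithmetic of `A + ξ B` -/

theorem root_mul_root (τ : k) :
    AdjoinRoot.root (X ^ 2 + C τ : k[X]) * AdjoinRoot.root (X ^ 2 + C τ : k[X]) =
      -AdjoinRoot.of (X ^ 2 + C τ : k[X]) τ := by
  have h : AdjoinRoot.mk (X ^ 2 + C τ : k[X]) (X ^ 2 + C τ) = 0 := AdjoinRoot.mk_self
  rw [map_add, map_pow, AdjoinRoot.mk_X, AdjoinRoot.mk_C] at h
  rw [← sq]
  exact eq_neg_of_add_eq_zero_left h

theorem complexify_mul (τ : k) (A B A' B' : Matrix (Fin n) (Fin n) k) :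
    complexify τ A B * complexify τ A' B' =
      complexify τ (A * A' - τ • (B * B')) (A * B' + B * A') := by
  have hs : ∀ M : Matrix (Fin n) (Fin n) k,
      (τ • M).map (AdjoinRoot.of (X ^ 2 + C τ : k[X])) =
        AdjoinRoot.of (X ^ 2 + C τ : k[X]) τ • M.map (AdjoinRoot.of (X ^ 2 + C τ : k[X])) := by
    intro M
    ext i j
    simp
  have hsub : ∀ M N : Matrix (Fin n) (Fin n) k,
      (M - N).map (AdjoinRoot.of (X ^ 2 + C τ : k[X])) =
        M.map (AdjoinRoot.of (X ^ 2 + C τ : k[X])) - N.map (AdjoinRoot.of (X ^ 2 + C τ : k[X])) := by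
    intro M N
    ext i j
    simp
  have hadd : ∀ M N : Matrix (Fin n) (Fin n) k,
      (M + N).map (AdjoinRoot.of (X ^ 2 + C τ : k[X])) =
        M.map (AdjoinRoot.of (X ^ 2 + C τ : k[X])) + N.map (AdjoinRoot.of (X ^ 2 + C τ : k[X])) := by
    intro M N
    ext i j
    simp
  simp only [complexify, hsub, hadd, hs, Matrix.map_mul, add_mul, mul_add, smul_mul_assoc,
    mul_smul_comm, smul_smul, root_mul_root, neg_smul, smul_add]
  abel

theorem complexify_one_zero (τ : k) :
    complexify τ (1 : Matrix (Fin n) (Fin n) k) 0 = 1 := by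
  ext i j
  simp only [complexify, Matrix.add_apply, Matrix.smul_apply, Matrix.map_apply, Matrix.one_apply]
  split_ifs <;> simp

/-- 1 and ξ are independent over k: entrywise, a polynomial of degree at most 1 divisible by x² + τ
is zero. -/
theorem complexify_injective (τ : k) {A B A' B' : Matrix (Fin n) (Fin n) k}
    (h : complexify τ A B = complexify τ A' B') : A = A' ∧ B = B' := by
  have key : ∀ i j, A i j - A' i j = 0 ∧ B i j - B' i j = 0 := by
    intro i j
    have hij := congrFun (congrFun h i) j
    simp only [complexify, Matrix.add_apply, Matrix.smul_apply, Matrix.map_apply,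
      smul_eq_mul] at hij
    have hmk : AdjoinRoot.mk (X ^ 2 + C τ : k[X])
        (C (B i j - B' i j) * X + C (A i j - A' i j)) = 0 := by
      simp only [map_add, map_mul, AdjoinRoot.mk_X, AdjoinRoot.mk_C, map_sub]
      linear_combination hij
    rw [AdjoinRoot.mk_eq_zero] at hmk
    have h0 := Polynomial.eq_zero_of_dvd_of_degree_lt hmk
      (lt_of_le_of_lt degree_linear_le (by rw [degree_X_pow_add_C (by norm_num)]; norm_num))
    have h1 := congrArg (fun p => coeff p 1) h0
    have h2 := congrArg (fun p => coeff p 0) h0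
    simp at h1 h2
    exact ⟨by simpa using h2, by simpa using h1⟩
  constructor <;> ext i j
  · exact sub_eq_zero.mp (key i j).1
  · exact sub_eq_zero.mp (key i j).2

theorem complexify_inv {A B U V : Matrix (Fin n) (Fin n) k}
    (h₁ : A * U - τ • (B * V) = 1) (h₂ : A * V + B * U = 0) :
    IsUnit (complexify τ A B) ∧ (complexify τ A B)⁻¹ = complexify τ U V := by
  have h : complexify τ A B * complexify τ U V = 1 := by
    rw [complexify_mul, h₁, h₂, complexify_one_zero]
  exact ⟨IsUnit.of_mul_eq_one _ h, Matrix.inv_eq_right_inv h⟩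

/-! ### Correctness and cost of Frobenius inversion -/

theorem frobenius₁_invertsOn (τ : k) (n : ℕ) : (frobenius₁ τ).InvertsOn (S₁ τ n) := by
  rintro Z ⟨A, B, rfl, -, hA, hS⟩
  set J := (A + τ • (B * A⁻¹ * B))⁻¹ with hJ
  have hAd := (Matrix.isUnit_iff_isUnit_det _).mp hA
  have hSd := (Matrix.isUnit_iff_isUnit_det _).mp hS
  have hSJ : (A + τ • (B * (A⁻¹ * B))) * J = 1 := by
    rw [← mul_assoc B]; exact Matrix.mul_nonsing_inv _ hSd
  have hJS : J * (A + τ • (B * (A⁻¹ * B))) = 1 := by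
    rw [← mul_assoc B]; exact Matrix.nonsing_inv_mul _ hSd
  refine ⟨A, B, J, -(A⁻¹ * B * J), rfl, (complexify_inv ?_ ?_).2, ?_⟩
  · rw [mul_neg, smul_neg, sub_neg_eq_add, ← hSJ, add_mul, smul_mul_assoc]
    simp only [mul_assoc]
  · rw [mul_neg, ← mul_assoc, ← mul_assoc, Matrix.mul_nonsing_inv _ hAd, one_mul,
      neg_add_cancel]
  · refine ⟨_, ⟨A⁻¹, ⟨A, rfl, Matrix.mul_nonsing_inv _ hAd, Matrix.nonsing_inv_mul _ hAd⟩,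
      _, ⟨_, _, rfl, rfl, rfl⟩, _, ⟨_, _, rfl, rfl, rfl⟩, _, ⟨_, rfl, rfl⟩, _, ⟨_, rfl, rfl⟩,
      _, ⟨_, _, rfl, rfl, rfl⟩, J, ⟨_, rfl, ?_, ?_⟩, _, ⟨_, _, rfl, rfl, rfl⟩,
      _, ⟨_, rfl, rfl⟩, rfl⟩, rfl, ?_⟩
    · rw [one_smul]; exact hSJ
    · rw [one_smul]; exact hJS
    · simp [frobenius₁]

theorem frobenius₂_invertsOn (τ : k) (n : ℕ) : (frobenius₂ τ).InvertsOn (S₂ τ n) := by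
  rintro Z ⟨A, B, rfl, -, hB, hS⟩
  set J := (τ • B + A * B⁻¹ * A)⁻¹ with hJ
  have hBd := (Matrix.isUnit_iff_isUnit_det _).mp hB
  have hSd := (Matrix.isUnit_iff_isUnit_det _).mp hS
  have hSJ : (τ • B + A * (B⁻¹ * A)) * J = 1 := by
    rw [← mul_assoc A]; exact Matrix.mul_nonsing_inv _ hSd
  have hJS : J * (τ • B + A * (B⁻¹ * A)) = 1 := by
    rw [← mul_assoc A]; exact Matrix.nonsing_inv_mul _ hSd
  refine ⟨A, B, B⁻¹ * A * J, -J, rfl, (complexify_inv ?_ ?_).2, ?_⟩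
  · rw [mul_neg, smul_neg, sub_neg_eq_add, ← hSJ, add_mul, smul_mul_assoc, add_comm]
    simp only [mul_assoc]
  · rw [mul_neg, ← mul_assoc, ← mul_assoc, Matrix.mul_nonsing_inv _ hBd, one_mul,
      neg_add_cancel]
  · refine ⟨_, ⟨B⁻¹, ⟨B, rfl, Matrix.mul_nonsing_inv _ hBd, Matrix.nonsing_inv_mul _ hBd⟩,
      _, ⟨_, _, rfl, rfl, rfl⟩, _, ⟨_, _, rfl, rfl, rfl⟩, _, ⟨_, rfl, rfl⟩, _, ⟨_, rfl, rfl⟩,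
      _, ⟨_, _, rfl, rfl, rfl⟩, J, ⟨_, rfl, ?_, ?_⟩, _, ⟨_, _, rfl, rfl, rfl⟩,
      _, ⟨_, rfl, rfl⟩, rfl⟩, rfl, ?_⟩
    · rw [one_smul]; exact hSJ
    · rw [one_smul]; exact hJS
    · simp [frobenius₂]

theorem frobeniusInversion_invertsAt (τ : k) (n : ℕ) (Z : Matrix (Fin n) (Fin n) (QuadExt τ))
    (hZ : Z ∈ S₁ τ n ∪ S₂ τ n) : (frobeniusInversion τ Z).InvertsAt Z := by
  unfold frobeniusInversion
  split_ifs with h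
  · exact frobenius₁_invertsOn τ n Z h
  · exact frobenius₂_invertsOn τ n Z (hZ.resolve_left h)

theorem frobeniusInversion_cost (τ : k) (Z : Matrix (Fin n) (Fin n) (QuadExt τ)) :
    (frobeniusInversion τ Z).invs = 2 ∧ (frobeniusInversion τ Z).muls = 3 ∧
      (frobeniusInversion τ Z).adds = 1 := by
  unfold frobeniusInversion
  split_ifs
  · exact ⟨rfl, rfl, rfl⟩
  · exact ⟨rfl, rfl, rfl⟩

/-! ### Consequences of irreducibility -/

theorem anisotropic (hτ : Irreducible (X ^ 2 + C τ : k[X])) {x y : k}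
    (h : x ^ 2 + τ * y ^ 2 = 0) : x = 0 ∧ y = 0 := by
  by_cases hy : y = 0
  · subst hy
    exact ⟨by simpa using h, rfl⟩
  · exfalso
    refine hτ.not_isRoot_of_natDegree_ne_one (x := x / y) ?_ ?_
    · rw [natDegree_X_pow_add_C]; norm_num
    · simp only [IsRoot, eval_add, eval_pow, eval_X, eval_C]
      field_simp
      linear_combination h

theorem tau_ne_zero (hτ : Irreducible (X ^ 2 + C τ : k[X])) : τ ≠ 0 := by
  rintro rfl
  have := (anisotropic hτ (x := 0) (y := 1) (by simp)).2
  exact one_ne_zero this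

/-- The field with two elements is excluded, since x² and x² + 1 are reducible over it. Three
distinct scalars 0, 1, t are all that the later interpolation arguments use. -/
theorem exists_ne_zero_ne_one (hτ : Irreducible (X ^ 2 + C τ : k[X])) :
    ∃ t : k, t ≠ 0 ∧ t ≠ 1 := by
  refine ⟨-τ, neg_ne_zero.mpr (tau_ne_zero hτ), fun h => ?_⟩
  have := (anisotropic hτ (x := 1) (y := 1) (by linear_combination -h)).2
  exact one_ne_zero this

/-! ### Running a program on a family of inputs at once -/

theorem getElem?_pi {ι R : Type*} [Nonempty ι] {s : List (ι → R)} {i : ℕ} {y : ι → R}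
    (hy : ∀ z, (s.map (· z))[i]? = some (y z)) : s[i]? = some y := by
  simp only [List.getElem?_map, Option.map_eq_some_iff] at hy
  obtain ⟨z₀⟩ := ‹Nonempty ι›
  obtain ⟨f, hf, -⟩ := hy z₀
  rw [hf]
  congr 1
  funext z
  obtain ⟨f', hf', hz⟩ := hy z
  rw [hf] at hf'
  cases hf'
  exact hz

/-- The instructions are the same at every input, so the pointwise results glue to functions;
inverses in the function ring are pointwise inverses. -/
theorem exec_pi {ι R : Type*} [Nonempty ι] [Ring R] [Algebra k R] (L : List (Instr k)) :
    ∀ (s : List (ι → R)) (t : ι → List R), (∀ z, Exec L (s.map (· z)) (t z)) →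
      ∃ T : List (ι → R), Exec L s T ∧ ∀ z, T.map (· z) = t z := by
  induction L with
  | nil => exact fun s t h => ⟨s, rfl, fun z => (h z).symm⟩
  | cons I L ih =>
    intro s t h
    choose x hx hL using h
    have hI : I.Yields s x := by
      cases I with
      | const c => exact funext hx
      | smul c i =>
        choose y hy hxy using hx
        exact ⟨y, getElem?_pi hy, funext hxy⟩
      | add i j =>
        choose y w hy hw hxy using hx
        exact ⟨y, w, getElem?_pi hy, getElem?_pi hw, funext hxy⟩
      | mul i j =>
        choose y w hy hw hxy using hx
        exact ⟨y, w, getElem?_pi hy, getElem?_pi hw, funext hxy⟩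
      | inv i =>
        choose y hy h₁ h₂ using hx
        exact ⟨y, getElem?_pi hy, funext h₁, funext h₂⟩
    obtain ⟨T, hT, hTt⟩ := ih (s ++ [x]) t (fun z => by simpa using hL z)
    exact ⟨T, ⟨x, hI, hT⟩, hTt⟩

theorem Program.computes_pi {ι R : Type*} [Nonempty ι] [Ring R] [Algebra k R] (Γ : Program k)
    {a b c d : ι → R} (h : ∀ z, Γ.Computes (a z) (b z) (c z) (d z)) : Γ.Computes a b c d := by
  choose t ht hc hd using h
  obtain ⟨T, hT, hTt⟩ := exec_pi Γ.code [a, b] t ht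
  exact ⟨T, hT, getElem?_pi fun z => by rw [hTt, hc], getElem?_pi fun z => by rw [hTt, hd]⟩

/-! ### Chains of spans of registers -/

/-- `W` arises from `V` by adjoining one product of members of `V`, or the inverse of one. -/
def Step {R : Type*} [Ring R] [Algebra k R] (V W : Submodule k R) : Prop :=
  ∃ r : R, W = V ⊔ Submodule.span k {r} ∧
    ((∃ u ∈ V, ∃ v ∈ V, r = u * v) ∨ ∃ u ∈ V, u * r = 1 ∧ r * u = 1)

/-- `W` arises from `V` by `N` consecutive steps. -/
def Chain {R : Type*} [Ring R] [Algebra k R] : ℕ → Submodule k R → Submodule k R → Prop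
  | 0, V, W => V = W
  | N + 1, V, W => ∃ V', Step V V' ∧ Chain N V' W

/-- Adjoining 1 = 1 · 1 is an idle step, so shorter chains can be padded. -/
theorem Chain.succ {R : Type*} [Ring R] [Algebra k R] {N : ℕ} {V W : Submodule k R}
    (h1 : (1 : R) ∈ V) (h : Chain N V W) : Chain (N + 1) V W := by
  refine ⟨V, ⟨1, ?_, Or.inl ⟨1, h1, 1, h1, (mul_one 1).symm⟩⟩, h⟩
  rw [eq_comm, sup_eq_left, Submodule.span_singleton_le_iff_mem]
  exact h1

theorem Chain.mono {R : Type*} [Ring R] [Algebra k R] {N N' : ℕ} {V W : Submodule k R}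
    (h1 : (1 : R) ∈ V) (h : Chain N V W) (hN : N ≤ N') : Chain N' V W := by
  induction hN with
  | refl => exact h
  | step _ ih => exact ih.succ h1

theorem exec_chain {R : Type*} [Ring R] [Algebra k R] (L : List (Instr k)) :
    ∀ (s t : List R) (V : Submodule k R), (1 : R) ∈ V → (∀ x ∈ s, x ∈ V) → Exec L s t →
      ∃ W, Chain (L.countP Instr.isMul + L.countP Instr.isInv) V W ∧ ∀ x ∈ t, x ∈ W := by
  induction L with
  | nil =>
    rintro s t V - hs rfl
    exact ⟨V, rfl, hs⟩
  | cons I L ih =>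
    rintro s t V h1 hs ⟨x, hI, hL⟩
    have reg : ∀ {i y}, s[i]? = some y → y ∈ V := fun h => hs _ (List.mem_of_getElem? h)
    have free (hx : x ∈ V) : ∃ W, Chain (L.countP Instr.isMul + L.countP Instr.isInv) V W ∧
        ∀ x ∈ t, x ∈ W := by
      refine ih (s ++ [x]) t V h1 (fun y hy => ?_) hL
      rcases List.mem_append.mp hy with hy | hy
      · exact hs y hy
      · rw [List.mem_singleton.mp hy]; exact hx
    have paid (hx : (∃ u ∈ V, ∃ v ∈ V, x = u * v) ∨ ∃ u ∈ V, u * x = 1 ∧ x * u = 1) :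
        ∃ W, Chain (L.countP Instr.isMul + L.countP Instr.isInv + 1) V W ∧ ∀ x ∈ t, x ∈ W := by
      obtain ⟨W, hW, ht⟩ := ih (s ++ [x]) t (V ⊔ Submodule.span k {x})
        (Submodule.mem_sup_left h1) (fun y hy => by
          rcases List.mem_append.mp hy with hy | hy
          · exact Submodule.mem_sup_left (hs y hy)
          · rw [List.mem_singleton.mp hy]
            exact Submodule.mem_sup_right (Submodule.mem_span_singleton_self x)) hL
      exact ⟨W, ⟨_, ⟨x, rfl, hx⟩, hW⟩, ht⟩
    cases I with
    | const c =>
      have hx : x = algebraMap k R c := hI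
      rw [Algebra.algebraMap_eq_smul_one] at hx
      simpa [List.countP_cons, Instr.isMul, Instr.isInv] using free (hx ▸ V.smul_mem c h1)
    | smul c i =>
      obtain ⟨y, hy, rfl⟩ := hI
      simpa [List.countP_cons, Instr.isMul, Instr.isInv] using free (V.smul_mem c (reg hy))
    | add i j =>
      obtain ⟨y, w, hy, hw, rfl⟩ := hI
      simpa [List.countP_cons, Instr.isMul, Instr.isInv] using free (V.add_mem (reg hy) (reg hw))
    | mul i j =>
      obtain ⟨y, w, hy, hw, hxy⟩ := hI
      have := paid (Or.inl ⟨y, reg hy, w, reg hw, hxy⟩)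
      simpa [List.countP_cons, Instr.isMul, Instr.isInv, add_right_comm] using this
    | inv i =>
      obtain ⟨y, hy, hyx⟩ := hI
      have := paid (Or.inr ⟨y, reg hy, hyx⟩)
      simpa [List.countP_cons, Instr.isMul, Instr.isInv, add_assoc] using this

/-- Two vectors are dependent modulo V because the quotient has dimension at most one. -/
theorem exists_linear_combination_mem {R : Type*} [Ring R] [Algebra k R] {V : Submodule k R}
    {r c d : R} (hc : c ∈ V ⊔ Submodule.span k {r}) (hd : d ∈ V ⊔ Submodule.span k {r}) :
    ∃ α β : k, (α ≠ 0 ∨ β ≠ 0) ∧ α • c + β • d ∈ V := by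
  obtain ⟨v, hv, w, hw, rfl⟩ := Submodule.mem_sup.mp hc
  obtain ⟨v', hv', w', hw', rfl⟩ := Submodule.mem_sup.mp hd
  obtain ⟨γ, rfl⟩ := Submodule.mem_span_singleton.mp hw
  obtain ⟨γ', rfl⟩ := Submodule.mem_span_singleton.mp hw'
  by_cases h : γ = 0
  · exact ⟨1, 0, Or.inl one_ne_zero, by simpa [h] using hv⟩
  · refine ⟨γ', -γ, Or.inr (neg_ne_zero.mpr h), ?_⟩
    have : γ' • (v + γ • r) + -γ • (v' + γ' • r) = γ' • v + -γ • v' := by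
      module
    rw [this]
    exact V.add_mem (V.smul_mem _ hv) (V.smul_mem _ hv')

/-! ### The inputs -/

/-- The pairs `(A, B)` with `A` and `A + τ B A⁻¹ B` invertible. -/
def Pt (τ : k) (n : ℕ) : Type _ :=
  {z : Matrix (Fin n) (Fin n) k × Matrix (Fin n) (Fin n) k //
    IsUnit z.1 ∧ IsUnit (z.1 + τ • (z.2 * z.1⁻¹ * z.2))}

/-- The first component of the input. -/
def fstIn (τ : k) (n : ℕ) : Pt τ n → Matrix (Fin n) (Fin n) k := fun z => z.1.1

/-- The second component of the input. -/
def sndIn (τ : k) (n : ℕ) : Pt τ n → Matrix (Fin n) (Fin n) k := fun z => z.1.2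

/-- The first component of the inverse. -/
noncomputable def fstOut (τ : k) (n : ℕ) : Pt τ n → Matrix (Fin n) (Fin n) k :=
  fun z => (z.1.1 + τ • (z.1.2 * z.1.1⁻¹ * z.1.2))⁻¹

/-- The second component of the inverse. -/
noncomputable def sndOut (τ : k) (n : ℕ) : Pt τ n → Matrix (Fin n) (Fin n) k :=
  fun z => -(z.1.1⁻¹ * z.1.2 * (z.1.1 + τ • (z.1.2 * z.1.1⁻¹ * z.1.2))⁻¹)

theorem in_mul_out_fst (z : Pt τ n) :
    fstIn τ n z * fstOut τ n z - τ • (sndIn τ n z * sndOut τ n z) = 1 := by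
  obtain ⟨⟨A, B⟩, hA, hS⟩ := z
  have hSJ := Matrix.mul_nonsing_inv _ ((Matrix.isUnit_iff_isUnit_det _).mp hS)
  simp only [fstIn, fstOut, sndIn, sndOut] at hSJ ⊢
  rw [add_mul, smul_mul_assoc] at hSJ
  rw [mul_neg, smul_neg, sub_neg_eq_add]
  simpa only [mul_assoc] using hSJ

theorem in_mul_out_snd (z : Pt τ n) :
    fstIn τ n z * sndOut τ n z + sndIn τ n z * fstOut τ n z = 0 := by
  obtain ⟨⟨A, B⟩, hA, hS⟩ := z
  simp only [fstIn, fstOut, sndIn, sndOut]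
  rw [mul_neg, ← mul_assoc, ← mul_assoc,
    Matrix.mul_nonsing_inv _ ((Matrix.isUnit_iff_isUnit_det _).mp hA), one_mul, neg_add_cancel]

/-- A scalar pair as an input. -/
noncomputable def scalarPt (τ : k) (n : ℕ) (s : k) (hs : 1 + τ * s ^ 2 ≠ 0) : Pt τ n :=
  ⟨(1, s • 1), isUnit_one, by
    have : (1 : Matrix (Fin n) (Fin n) k) + τ • (s • 1 * 1⁻¹ * s • 1) =
        algebraMap k _ (1 + τ * s ^ 2) := by
      rw [Algebra.algebraMap_eq_smul_one, inv_one, mul_one, smul_mul_smul_comm, mul_one, smul_smul,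
        add_smul, one_smul, sq]
    rw [this]
    exact (IsUnit.mk0 _ hs).map _⟩

theorem Program.InvertsOn.computes₁ {Γ : Program k} (h : Γ.InvertsOn (S₁ τ n)) :
    Γ.Computes (fstIn τ n) (sndIn τ n) (fstOut τ n) (sndOut τ n) := by
  have : Nonempty (Pt τ n) := ⟨scalarPt τ n 0 (by simp)⟩
  refine Γ.computes_pi fun z => ?_
  have hinv := complexify_inv (in_mul_out_fst z) (in_mul_out_snd z)
  obtain ⟨A, B, U, V, hZ, hZ', hc⟩ := h (complexify τ (fstIn τ n z) (sndIn τ n z))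
    ⟨_, _, rfl, hinv.1, z.2.1, z.2.2⟩
  obtain ⟨rfl, rfl⟩ := complexify_injective τ hZ
  rw [hinv.2] at hZ'
  obtain ⟨rfl, rfl⟩ := complexify_injective τ hZ'
  exact hc

/-- The program is fed ξ(A + ξB) = -τB + ξA, whose inverse is (C + ξD)(-ξ/τ) = D - ξC/τ. -/
theorem Program.InvertsOn.computes₂ {Γ : Program k} (hτ : τ ≠ 0) (h : Γ.InvertsOn (S₂ τ n)) :
    Γ.Computes (-τ • sndIn τ n) (fstIn τ n) (sndOut τ n) (-τ⁻¹ • fstOut τ n) := by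
  have : Nonempty (Pt τ n) := ⟨scalarPt τ n 0 (by simp)⟩
  refine Γ.computes_pi fun z => ?_
  have h₁ := in_mul_out_fst z
  have h₂ := in_mul_out_snd z
  have hinv : IsUnit (complexify τ (-τ • sndIn τ n z) (fstIn τ n z)) ∧
      (complexify τ (-τ • sndIn τ n z) (fstIn τ n z))⁻¹ =
        complexify τ (sndOut τ n z) (-τ⁻¹ • fstOut τ n z) := by
    apply complexify_inv
    · rw [← h₁, mul_smul_comm, smul_smul, smul_mul_assoc, mul_neg, mul_inv_cancel₀ hτ]
      simp only [neg_smul, one_smul]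
      abel
    · rw [← h₂, smul_mul_smul_comm, neg_mul_neg, mul_inv_cancel₀ hτ, one_smul, add_comm]
  obtain ⟨A, B, U, V, hZ, hZ', hc⟩ := h (complexify τ (-τ • sndIn τ n z) (fstIn τ n z))
    ⟨_, _, rfl, hinv.1, z.2.1, by
      have : τ • fstIn τ n z + -τ • sndIn τ n z * (fstIn τ n z)⁻¹ * -τ • sndIn τ n z =
          τ • (z.1.1 + τ • (z.1.2 * z.1.1⁻¹ * z.1.2)) := by
        simp only [fstIn, sndIn, smul_mul_assoc, mul_smul_comm, smul_smul, smul_add, neg_mul_neg]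
      rw [this]
      exact z.2.2.smul (Units.mk0 τ hτ)⟩
  obtain ⟨rfl, rfl⟩ := complexify_injective τ hZ
  rw [hinv.2] at hZ'
  obtain ⟨rfl, rfl⟩ := complexify_injective τ hZ'
  exact hc

/-! ### The addition -/

/-- The condition survives scalar multiples and products; an invertible register cannot vanish at
`z₀`, and equal values have equal inverses. -/
theorem exec_without_add {ι R : Type*} [Ring R] [Nontrivial R] [Algebra k R] (z₀ z₁ : ι)
    (L : List (Instr k)) :
    ∀ s t : List (ι → R), L.countP Instr.isAdd = 0 →
      (∀ x ∈ s, x z₀ = 0 ∨ x z₀ = x z₁) → Exec L s t → ∀ x ∈ t, x z₀ = 0 ∨ x z₀ = x z₁ := by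
  induction L with
  | nil =>
    rintro s t - hs rfl
    exact hs
  | cons I L ih =>
    rintro s t h0 hs ⟨x, hI, hL⟩
    rw [List.countP_cons] at h0
    have reg : ∀ {i : ℕ} {y : ι → R}, s[i]? = some y → y z₀ = 0 ∨ y z₀ = y z₁ :=
      fun h => hs _ (List.mem_of_getElem? h)
    refine ih (s ++ [x]) t (by omega) (fun x' hx' => ?_) hL
    rcases List.mem_append.mp hx' with hx' | hx'
    · exact hs x' hx'
    rw [List.mem_singleton.mp hx']
    clear hx'
    cases I with
    | const c =>
      have hx : x = algebraMap k (ι → R) c := hI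
      right
      rw [hx]
      rfl
    | smul c i =>
      obtain ⟨y, hy, rfl⟩ := hI
      rcases reg hy with h | h
      · left; simp [h]
      · right; simp [h]
    | add i j => simp [Instr.isAdd] at h0
    | mul i j =>
      obtain ⟨y, w, hy, hw, rfl⟩ := hI
      rcases reg hy with h | h
      · left; simp [h]
      rcases reg hw with h' | h'
      · left; simp [h']
      · right; simp [h, h']
    | inv i =>
      obtain ⟨y, hy, h₁, h₂⟩ := hI
      have e₁ := congrFun h₂ z₀
      have e₂ := congrFun h₁ z₁
      simp only [Pi.mul_apply, Pi.one_apply] at e₁ e₂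
      rcases reg hy with h | h
      · rw [h, mul_zero] at e₁
        exact absurd e₁ zero_ne_one
      · right
        rw [h] at e₁
        exact left_inv_eq_right_inv e₁ e₂

theorem one_le_adds (hτ : Irreducible (X ^ 2 + C τ : k[X])) (hn : n ≠ 0) {Γ : Program k}
    (h : Γ.InvertsOn (S₁ τ n) ∨ Γ.InvertsOn (S₂ τ n)) : 1 ≤ Γ.adds := by
  have hτ0 := tau_ne_zero hτ
  have : NeZero n := ⟨hn⟩
  have h1 : 1 + τ * 1 ^ 2 ≠ 0 := fun h => one_ne_zero (anisotropic hτ (x := 1) (y := 1)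
    (by simpa using h)).1
  by_contra hlt
  have h0 : Γ.code.countP Instr.isAdd = 0 := by
    have : Γ.adds = 0 := by omega
    exact this
  set z₀ := scalarPt τ n 0 (by simp)
  set z₁ := scalarPt τ n 1 h1
  have hA : fstIn τ n z₀ = 0 ∨ fstIn τ n z₀ = fstIn τ n z₁ := Or.inr rfl
  have hB : sndIn τ n z₀ = 0 ∨ sndIn τ n z₀ = sndIn τ n z₁ := Or.inl (zero_smul _ _)
  have hC : fstOut τ n z₀ = 0 ∨ fstOut τ n z₀ = fstOut τ n z₁ := by
    rcases h with h | h
    · obtain ⟨t, ht, hc, -⟩ := h.computes₁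
      refine exec_without_add z₀ z₁ _ _ _ h0 ?_ ht _ (List.mem_of_getElem? hc)
      simp only [List.mem_cons, List.not_mem_nil, or_false, forall_eq_or_imp, forall_eq]
      exact ⟨hA, hB⟩
    · obtain ⟨t, ht, -, hc⟩ := h.computes₂ hτ0
      have := exec_without_add z₀ z₁ _ _ _ h0 ?_ ht _ (List.mem_of_getElem? hc)
      · simpa [hτ0] using this
      · simp only [List.mem_cons, List.not_mem_nil, or_false, forall_eq_or_imp, forall_eq]
        exact ⟨by simpa [hτ0] using hB, hA⟩
  have e₀ := in_mul_out_fst z₀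
  have e₁ := in_mul_out_fst z₁
  have f₁ := in_mul_out_snd z₁
  have a₀ : fstIn τ n z₀ = 1 := rfl
  have a₁ : fstIn τ n z₁ = 1 := rfl
  have b₀ : sndIn τ n z₀ = 0 := zero_smul _ _
  have b₁ : sndIn τ n z₁ = 1 := one_smul _ _
  rw [a₀, b₀, one_mul, zero_mul, smul_zero, sub_zero] at e₀
  rw [a₁, b₁, one_mul, one_mul] at e₁ f₁
  rw [e₀] at hC
  -- C is 1 at (1, 0). If it were also 1 at (1, 1), then D = -1 there, and the first equation would
  -- read 1 + τ = 1.
  have hC' := hC.resolve_left one_ne_zero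
  rw [← hC'] at e₁ f₁
  rw [eq_neg_of_add_eq_zero_left f₁, smul_neg, sub_neg_eq_add, add_eq_left] at e₁
  exact (smul_ne_zero hτ0 one_ne_zero) e₁

/-! ### Matrices with a prescribed annihilator -/

/-- The matrix of multiplication by the class of x on k[x]/(g). -/
theorem exists_matrix_aeval_eq_zero_iff {g : k[X]} (hg : g.Monic) (hn : g.natDegree = n) :
    ∃ M : Matrix (Fin n) (Fin n) k, ∀ f : k[X], aeval M f = 0 ↔ g ∣ f := by
  subst hn
  let pb := AdjoinRoot.powerBasis' hg
  let φ := Algebra.leftMulMatrix (pb.basis.reindex (finCongr (AdjoinRoot.powerBasis'_dim hg)))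
  refine ⟨φ (AdjoinRoot.root g), fun f => ?_⟩
  rw [aeval_algHom_apply, map_eq_zero_iff φ (Algebra.leftMulMatrix_injective _),
    AdjoinRoot.aeval_eq, AdjoinRoot.mk_eq_zero]

theorem isUnit_aeval_of_isCoprime {M : Matrix (Fin n) (Fin n) k} {f g : k[X]}
    (hg : aeval M g = 0) (h : IsCoprime f g) : IsUnit (aeval M f) := by
  obtain ⟨u, v, huv⟩ := h
  have := congrArg (aeval M) huv
  rw [map_add, map_mul, map_mul, hg, mul_zero, add_zero, map_one] at this
  exact IsUnit.of_mul_eq_one_right _ this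

/-- With g = d h and d dividing f, f(M) h(M) = 0, while h(M) ≠ 0 because g does not divide h. -/
theorem not_isUnit_aeval {M : Matrix (Fin n) (Fin n) k} {d f g : k[X]} (hg0 : g ≠ 0)
    (hg : ∀ f : k[X], aeval M f = 0 ↔ g ∣ f) (hd : ¬ IsUnit d) (hdf : d ∣ f) (hdg : d ∣ g) :
    ¬ IsUnit (aeval M f) := by
  intro hu
  obtain ⟨e, rfl⟩ := hdf
  obtain ⟨h, rfl⟩ := hdg
  have h0 : aeval M (d * e) * aeval M h = 0 := by
    rw [← map_mul, hg]
    exact ⟨e, by ring⟩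
  have h1 : aeval M h = 0 := (hu.mul_right_eq_zero).mp h0
  rw [hg] at h1
  have hh : h ≠ 0 := right_ne_zero_of_mul hg0
  obtain ⟨w, hw⟩ := h1
  have : d * w = 1 := mul_right_cancel₀ hh (by linear_combination -hw)
  exact hd (IsUnit.of_mul_eq_one _ this)

/-- The monic multiple of degree `n` of a monic quadratic polynomial. -/
theorem monic_mul_X_sub_C_pow (hn : 2 ≤ n) {m : k[X]} (hm : m.Monic) (hm2 : m.natDegree = 2)
    (c : k) : (m * (X - C c) ^ (n - 2)).Monic ∧ (m * (X - C c) ^ (n - 2)).natDegree = n := by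
  have h1 : ((X - C c) ^ (n - 2) : k[X]).Monic := (monic_X_sub_C c).pow _
  refine ⟨hm.mul h1, ?_⟩
  rw [hm.natDegree_mul h1, hm2, (monic_X_sub_C c).natDegree_pow, natDegree_X_sub_C]
  omega

theorem isCoprime_X_sub_C {p : k[X]} {c : k} (h : p.eval c ≠ 0) : IsCoprime p (X - C c) := by
  refine ((irreducible_X_sub_C c).coprime_iff_not_dvd.mpr ?_).symm
  rw [dvd_iff_isRoot]
  exact h

theorem isCoprime_C_left {a : k} (ha : a ≠ 0) (p : k[X]) : IsCoprime (C a) p :=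
  ⟨C a⁻¹, 0, by rw [← C_mul, inv_mul_cancel₀ ha, C_1, zero_mul, add_zero]⟩

/-! ### A polynomial with too many quadratic divisors vanishes -/

/-- Over 𝔽 the polynomial has ten roots with multiplicity: the eight nonzero a + ξb with a, b in {0,
1, t}, since (X - a)² + τb² divides it, and 1 and t once more, since (X - a)² divides it. This works
even over the field with three elements. -/
theorem eq_zero_of_forall_quadratic_dvd (hτ : Irreducible (X ^ 2 + C τ : k[X])) {h : k[X]}
    (hdeg : h.natDegree ≤ 9)
    (hdvd : ∀ m : k[X], m.Monic → m.natDegree = 2 → m.eval 0 ≠ 0 → m ∣ h) : h = 0 := by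
  classical
  have : Fact (Irreducible (X ^ 2 + C τ : k[X])) := ⟨hτ⟩
  by_contra h0
  obtain ⟨t, ht0, ht1⟩ := exists_ne_zero_ne_one hτ
  let K := AdjoinRoot (X ^ 2 + C τ : k[X])
  let i : k →+* K := AdjoinRoot.of _
  have hi : Function.Injective i := i.injective
  let e : k × k → K := fun x => i x.1 + AdjoinRoot.root _ * i x.2
  have he : Function.Injective e := by
    rintro ⟨a, b⟩ ⟨a', b'⟩ hab
    have := complexify_injective τ (n := 1) (A := fun _ _ => a) (B := fun _ _ => b)
      (A' := fun _ _ => a') (B' := fun _ _ => b') (by ext _ _; exact hab)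
    exact Prod.ext (congrFun (congrFun this.1 0) 0) (congrFun (congrFun this.2 0) 0)
  let T : Finset (k × k) := (({0, 1, t} : Finset k) ×ˢ ({0, 1, t} : Finset k)).erase (0, 0)
  -- The roots counted a second time.
  let T' : Finset (k × k) := ({1, t} : Finset k) ×ˢ {0}
  have hc3 : ({0, 1, t} : Finset k).card = 3 := by
    rw [Finset.card_eq_three]
    exact ⟨0, 1, t, zero_ne_one, ht0.symm, ht1.symm, rfl⟩
  have hT : T.card = 8 := by
    rw [Finset.card_erase_of_mem (by simp), Finset.card_product, hc3]
  have hT' : T'.card = 2 := by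
    rw [Finset.card_product, Finset.card_pair ht1.symm, Finset.card_singleton]
  have hq : ∀ a b : k, (a, b) ≠ (0, 0) → (X - C a) ^ 2 + C (τ * b ^ 2) ∣ h := by
    intro a b hab
    have hlt : (C (τ * b ^ 2)).degree < ((X - C a) ^ 2 : k[X]).degree := by
      rw [degree_pow, degree_X_sub_C]
      exact lt_of_le_of_lt degree_C_le (by norm_num)
    refine hdvd _ (((monic_X_sub_C a).pow 2).add_of_left hlt) ?_ ?_
    · rw [natDegree_add_eq_left_of_degree_lt hlt, natDegree_pow, natDegree_X_sub_C]
    · intro h0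
      have := anisotropic hτ (x := a) (y := b) (by simpa using h0)
      exact hab (by rw [this.1, this.2])
  let H : K[X] := h.map i
  have hH0 : H ≠ 0 := (Polynomial.map_ne_zero_iff hi).mpr h0
  have hle : (T.map ⟨e, he⟩).val + (T'.map ⟨e, he⟩).val ≤ H.roots := by
    rw [Multiset.le_iff_count]
    intro y
    rw [Multiset.count_add, count_roots]
    by_cases hy' : y ∈ T'.map ⟨e, he⟩
    · have hb : Multiset.count y (T.map ⟨e, he⟩).val + Multiset.count y (T'.map ⟨e, he⟩).val ≤ 2 :=
        add_le_add (Multiset.nodup_iff_count_le_one.mp (Finset.nodup _) y)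
          (Multiset.nodup_iff_count_le_one.mp (Finset.nodup _) y)
      refine hb.trans ((le_rootMultiplicity_iff hH0).mpr ?_)
      obtain ⟨⟨a, b⟩, hab, rfl⟩ := Finset.mem_map.mp hy'
      have hb0 : b = 0 := Finset.mem_singleton.mp (Finset.mem_product.mp hab).2
      have ha0 : a ≠ 0 := by
        have := (Finset.mem_product.mp hab).1
        simp only [Finset.mem_insert, Finset.mem_singleton] at this
        rcases this with rfl | rfl
        · exact one_ne_zero
        · exact ht0
      subst hb0
      have := Polynomial.map_dvd i (hq a 0 (fun h => ha0 (congrArg Prod.fst h)))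
      simpa [e] using this
    · rw [Multiset.count_eq_zero_of_notMem (s := (T'.map ⟨e, he⟩).val) hy', add_zero]
      by_cases hy : y ∈ T.map ⟨e, he⟩
      · refine (Multiset.nodup_iff_count_le_one.mp (Finset.nodup _) y).trans ?_
        rw [Nat.one_le_iff_ne_zero, ← Nat.pos_iff_ne_zero, rootMultiplicity_pos hH0]
        obtain ⟨⟨a, b⟩, hab, rfl⟩ := Finset.mem_map.mp hy
        have := Polynomial.map_dvd i (hq a b (Finset.ne_of_mem_erase hab))
        refine IsRoot.dvd ?_ this
        have hr : AdjoinRoot.root (X ^ 2 + C τ : k[X]) * AdjoinRoot.root (X ^ 2 + C τ : k[X]) =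
            -i τ := root_mul_root τ
        simp only [Function.Embedding.coeFn_mk, e, IsRoot, Polynomial.map_add, Polynomial.map_pow,
          Polynomial.map_sub, map_X, map_C, eval_add, eval_pow, eval_sub, eval_X, eval_C,
          map_mul, map_pow, Polynomial.map_mul, eval_mul]
        linear_combination (i b) ^ 2 * hr
      · rw [Multiset.count_eq_zero_of_notMem (s := (T.map ⟨e, he⟩).val) hy]
        exact Nat.zero_le _
  have hcard := (Multiset.card_le_card hle).trans (card_roots' H)
  rw [Multiset.card_add, Finset.card_val, Finset.card_val, Finset.card_map, Finset.card_map, hT,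
    hT', natDegree_map] at hcard
  omega

theorem natDegree_norm_poly (hτ : τ ≠ 0) (a : k) :
    (C (a ^ 2) + C τ * X ^ 2 : k[X]).natDegree = 2 := by
  have : (C (a ^ 2) + C τ * X ^ 2 : k[X]) = C τ * X ^ 2 + C 0 * X + C (a ^ 2) := by
    rw [map_zero]; ring
  rw [this, natDegree_quadratic hτ]

theorem irreducible_norm_poly (hτ : Irreducible (X ^ 2 + C τ : k[X])) {a : k} (ha : a ≠ 0) :
    Irreducible (C (a ^ 2) + C τ * X ^ 2 : k[X]) := by
  have hτ0 := tau_ne_zero hτ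
  have hd := natDegree_norm_poly hτ0 a
  refine (irreducible_iff_roots_eq_zero_of_degree_le_three (by rw [hd]) (by rw [hd]; norm_num)).mpr
    (Multiset.eq_zero_of_forall_notMem fun x hx => ?_)
  have := isRoot_of_mem_roots hx
  simp only [IsRoot, eval_add, eval_C, eval_mul, eval_pow, eval_X] at this
  exact ha (anisotropic hτ this).1

/-! ### Functions of the input along polynomial families of commuting pairs -/

/-- On the inputs of the form `(pA(M), pB(M))` the function `f` takes the value `p(M)`. -/
def Rep (pA pB : k[X]) (f : Pt τ n → Matrix (Fin n) (Fin n) k) (p : k[X]) : Prop :=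
  ∀ (z : Pt τ n) (M : Matrix (Fin n) (Fin n) k),
    fstIn τ n z = aeval M pA → sndIn τ n z = aeval M pB → f z = aeval M p

section Rep

variable {pA pB p q : k[X]} {f g : Pt τ n → Matrix (Fin n) (Fin n) k}

theorem Rep.one : Rep pA pB (1 : Pt τ n → Matrix (Fin n) (Fin n) k) 1 := by
  intro z M _ _
  simp

theorem Rep.fstIn : Rep pA pB (fstIn τ n) pA := fun _ _ h _ => h

theorem Rep.sndIn : Rep pA pB (sndIn τ n) pB := fun _ _ _ h => h

theorem Rep.add (hf : Rep pA pB f p) (hg : Rep pA pB g q) : Rep pA pB (f + g) (p + q) := by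
  intro z M h₁ h₂
  rw [Pi.add_apply, hf z M h₁ h₂, hg z M h₁ h₂, map_add]

theorem Rep.mul (hf : Rep pA pB f p) (hg : Rep pA pB g q) : Rep pA pB (f * g) (p * q) := by
  intro z M h₁ h₂
  rw [Pi.mul_apply, hf z M h₁ h₂, hg z M h₁ h₂, map_mul]

theorem Rep.smul (c : k) (hf : Rep pA pB f p) : Rep pA pB (c • f) (C c * p) := by
  intro z M h₁ h₂
  rw [Pi.smul_apply, hf z M h₁ h₂, map_mul, aeval_C, Algebra.smul_def]

end Rep

theorem schur_mul_fst {z : Pt τ n} {M : Matrix (Fin n) (Fin n) k} {pA pB : k[X]}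
    (hA : fstIn τ n z = aeval M pA) (hB : sndIn τ n z = aeval M pB) :
    (fstIn τ n z + τ • (sndIn τ n z * (fstIn τ n z)⁻¹ * sndIn τ n z)) * fstIn τ n z =
      aeval M (pA ^ 2 + C τ * pB ^ 2) := by
  have hu := (Matrix.isUnit_iff_isUnit_det _).mp z.2.1
  have hcomm : sndIn τ n z * fstIn τ n z = fstIn τ n z * sndIn τ n z := by
    rw [hA, hB, ← map_mul, mul_comm, map_mul]
  rw [add_mul, smul_mul_assoc, mul_assoc, hcomm, mul_assoc, ← mul_assoc _⁻¹]
  rw [show (fstIn τ n z)⁻¹ * fstIn τ n z = 1 from Matrix.nonsing_inv_mul _ hu, one_mul, hA, hB,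
    map_add, map_mul, aeval_C, map_pow, map_pow, sq, sq, Algebra.smul_def]

theorem fstOut_mul {z : Pt τ n} {M : Matrix (Fin n) (Fin n) k} {pA pB : k[X]}
    (hA : fstIn τ n z = aeval M pA) (hB : sndIn τ n z = aeval M pB) :
    fstOut τ n z * aeval M (pA ^ 2 + C τ * pB ^ 2) = aeval M pA := by
  rw [← schur_mul_fst hA hB, ← mul_assoc]
  have := Matrix.nonsing_inv_mul _ ((Matrix.isUnit_iff_isUnit_det _).mp z.2.2)
  rw [show fstOut τ n z *
    (fstIn τ n z + τ • (sndIn τ n z * (fstIn τ n z)⁻¹ * sndIn τ n z)) = 1 from this, one_mul, hA]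

theorem sndOut_mul {z : Pt τ n} {M : Matrix (Fin n) (Fin n) k} {pA pB : k[X]}
    (hA : fstIn τ n z = aeval M pA) (hB : sndIn τ n z = aeval M pB) :
    sndOut τ n z * aeval M (pA ^ 2 + C τ * pB ^ 2) = -aeval M pB := by
  have hu := (Matrix.isUnit_iff_isUnit_det _).mp z.2.1
  have h : sndOut τ n z = -((fstIn τ n z)⁻¹ * sndIn τ n z * fstOut τ n z) := rfl
  have hcomm : sndIn τ n z * fstIn τ n z = fstIn τ n z * sndIn τ n z := by
    rw [hA, hB, ← map_mul, mul_comm, map_mul]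
  rw [h, neg_mul, mul_assoc, fstOut_mul hA hB, ← hA, mul_assoc, hcomm, ← mul_assoc,
    show (fstIn τ n z)⁻¹ * fstIn τ n z = 1 from Matrix.nonsing_inv_mul _ hu, one_mul, hB]

/-- Clears the denominator: C and D become `pA` and `-pB` after multiplication by `pA ^ 2 + C τ * pB
^ 2`. -/
theorem rep_out_mul {pA pB q : k[X]} {α β : k}
    {u : Pt τ n → Matrix (Fin n) (Fin n) k} (hu : Rep pA pB u q)
    {p : k[X]} (h : Rep pA pB ((α • fstOut τ n + β • sndOut τ n) * u) p) :
    Rep pA pB (0 : Pt τ n → Matrix (Fin n) (Fin n) k)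
      (p * (pA ^ 2 + C τ * pB ^ 2) - (C α * pA - C β * pB) * q) := by
  intro z M hA hB
  have e := h z M hA hB
  rw [Pi.mul_apply, hu z M hA hB] at e
  rw [map_sub, map_mul, ← e, mul_assoc, ← map_mul, mul_comm q, map_mul, ← mul_assoc,
    Pi.add_apply, Pi.smul_apply, Pi.smul_apply, add_mul, smul_mul_assoc, smul_mul_assoc,
    fstOut_mul hA hB, sndOut_mul hA hB]
  simp only [map_mul, map_sub, aeval_C, Algebra.smul_def, Pi.zero_apply]
  noncomm_ring

theorem exists_pt {M : Matrix (Fin n) (Fin n) k} {g pA pB : k[X]} (hg : aeval M g = 0)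
    (hA : IsCoprime pA g) (hQ : IsCoprime (pA ^ 2 + C τ * pB ^ 2) g) :
    ∃ z : Pt τ n, fstIn τ n z = aeval M pA ∧ sndIn τ n z = aeval M pB := by
  have uA := isUnit_aeval_of_isCoprime hg hA
  have uQ := isUnit_aeval_of_isCoprime hg hQ
  have hu := (Matrix.isUnit_iff_isUnit_det _).mp uA
  refine ⟨⟨(aeval M pA, aeval M pB), uA, ?_⟩, rfl, rfl⟩
  have e : aeval M pA + τ • (aeval M pB * (aeval M pA)⁻¹ * aeval M pB) =
      (aeval M pA)⁻¹ * aeval M (pA ^ 2 + C τ * pB ^ 2) := by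
    have hcomm : aeval M pB * (aeval M pA)⁻¹ = (aeval M pA)⁻¹ * aeval M pB := by
      have hc : aeval M pB * aeval M pA = aeval M pA * aeval M pB := by
        rw [← map_mul, mul_comm, map_mul]
      calc aeval M pB * (aeval M pA)⁻¹
          = (aeval M pA)⁻¹ * (aeval M pA * aeval M pB) * (aeval M pA)⁻¹ := by
            rw [← mul_assoc, Matrix.nonsing_inv_mul _ hu, one_mul]
        _ = (aeval M pA)⁻¹ * aeval M pB := by
            rw [← hc, mul_assoc, mul_assoc, Matrix.mul_nonsing_inv _ hu, mul_one]
    rw [hcomm, map_add, map_mul, map_pow, map_pow, aeval_C, ← Algebra.smul_def, mul_add,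
      mul_smul_comm, sq, sq, ← mul_assoc, Matrix.nonsing_inv_mul _ hu, one_mul, mul_assoc]
  rw [e]
  exact IsUnit.mul ((Matrix.isUnit_nonsing_inv_iff).mpr uA) uQ

/-- M is chosen with annihilator m (X - c)^(n-2). The coprimality conditions make (pA(M), pB(M)) an
admissible input, and the padding factor at c only fills up the size n. -/
theorem dvd_of_rep_zero {pA pB h m : k[X]} (hn : 2 ≤ n)
    (hr : Rep pA pB (0 : Pt τ n → Matrix (Fin n) (Fin n) k) h) (hm : m.Monic)
    (hm2 : m.natDegree = 2) (hA : IsCoprime pA m) (hQ : IsCoprime (pA ^ 2 + C τ * pB ^ 2) m)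
    {c : k} (hAc : pA.eval c ≠ 0) (hQc : (pA ^ 2 + C τ * pB ^ 2).eval c ≠ 0) : m ∣ h := by
  obtain ⟨hg, hgn⟩ := monic_mul_X_sub_C_pow hn hm hm2 c
  obtain ⟨M, hM⟩ := exists_matrix_aeval_eq_zero_iff hg hgn
  obtain ⟨z, hzA, hzB⟩ := exists_pt (τ := τ) (pB := pB) ((hM _).mpr dvd_rfl)
    (hA.mul_right (isCoprime_X_sub_C hAc).pow_right)
    (hQ.mul_right (isCoprime_X_sub_C hQc).pow_right)
  exact (dvd_mul_right _ _).trans ((hM h).mp (hr z M hzA hzB).symm)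

theorem not_dvd_of_rep_unit {pA pB p q : k[X]} (hn : 2 ≤ n)
    {u r : Pt τ n → Matrix (Fin n) (Fin n) k} (hr : Rep pA pB u p) (hur : u * r = 1)
    (hq : q.Monic) (hqi : Irreducible q) (hq2 : q.natDegree ≤ 2)
    (hA : IsCoprime pA q) (hQ : IsCoprime (pA ^ 2 + C τ * pB ^ 2) q)
    {c : k} (hAc : pA.eval c ≠ 0) (hQc : (pA ^ 2 + C τ * pB ^ 2).eval c ≠ 0) : ¬ q ∣ p := by
  intro hqp
  obtain ⟨m, hm, hm2, hqm, hmA, hmQ⟩ : ∃ m : k[X], m.Monic ∧ m.natDegree = 2 ∧ q ∣ m ∧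
      IsCoprime pA m ∧ IsCoprime (pA ^ 2 + C τ * pB ^ 2) m := by
    have h0 := hqi.natDegree_pos
    rcases (show q.natDegree = 1 ∨ q.natDegree = 2 by omega) with h | h
    -- A linear factor is squared to reach degree 2, so that n = 2 needs no separate treatment.
    · exact ⟨q ^ 2, hq.pow 2, by rw [hq.natDegree_pow, h], dvd_pow_self q two_ne_zero,
        hA.pow_right, hQ.pow_right⟩
    · exact ⟨q, hq, h, dvd_rfl, hA, hQ⟩
  obtain ⟨hg, hgn⟩ := monic_mul_X_sub_C_pow hn hm hm2 c
  obtain ⟨M, hM⟩ := exists_matrix_aeval_eq_zero_iff hg hgn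
  obtain ⟨z, hzA, hzB⟩ := exists_pt (τ := τ) (pB := pB) ((hM _).mpr dvd_rfl)
    (hmA.mul_right (isCoprime_X_sub_C hAc).pow_right)
    (hmQ.mul_right (isCoprime_X_sub_C hQc).pow_right)
  refine not_isUnit_aeval hg.ne_zero hM hqi.not_isUnit hqp (hqm.trans (dvd_mul_right _ _)) ?_
  rw [← hr z M hzA hzB]
  exact IsUnit.of_mul_eq_one _ (congrFun hur z)

theorem exists_monic_irreducible_dvd {p : k[X]} (h0 : p ≠ 0) (hp : ¬ IsUnit p) :
    ∃ q : k[X], q.Monic ∧ Irreducible q ∧ q ∣ p ∧ q.natDegree ≤ p.natDegree := by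
  obtain ⟨q, hq, hqp⟩ := WfDvdMonoid.exists_irreducible_factor hp h0
  have hq0 : q.leadingCoeff⁻¹ ≠ 0 := inv_ne_zero (leadingCoeff_ne_zero.mpr hq.ne_zero)
  have ha : Associated (q * C q.leadingCoeff⁻¹) q :=
    associated_mul_unit_left q _ (isUnit_C.mpr (IsUnit.mk0 _ hq0))
  have hd := ha.dvd.trans hqp
  exact ⟨_, monic_mul_leadingCoeff_inv hq.ne_zero, ha.symm.irreducible hq, hd,
    natDegree_le_of_dvd hd h0⟩

/-! ### The family with scalar first component -/

theorem eq_zero_of_rep_scalar (hτ : Irreducible (X ^ 2 + C τ : k[X])) (hn : 2 ≤ n)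
    {a : k} (ha : a ≠ 0) {h : k[X]} (hd : h.natDegree ≤ 7)
    (hr : Rep (C a) X (0 : Pt τ n → Matrix (Fin n) (Fin n) k) h) : h = 0 := by
  have hirr := irreducible_norm_poly hτ ha
  have hpd : (C (a ^ 2) + C τ * X ^ 2 : k[X]).natDegree ≤ 2 := by compute_degree
  -- Quadratics associated to the norm polynomial give no admissible input; the extra factor makes
  -- them divisors as well, at the price of two degrees out of nine.
  suffices h * (C (a ^ 2) + C τ * X ^ 2) = 0 from
    (mul_eq_zero.mp this).resolve_right hirr.ne_zero
  refine eq_zero_of_forall_quadratic_dvd hτ (natDegree_mul_le.trans (by omega)) ?_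
  intro m hm hm2 hm0
  rcases hirr.isCoprime_or_dvd m with hc | hdvd
  · refine Dvd.dvd.mul_right (dvd_of_rep_zero hn hr hm hm2 ?_ ?_ (c := 0) ?_ ?_) _
    · exact isCoprime_C_left ha _
    · rwa [← C_pow]
    · simpa using ha
    · simpa using ha
  · refine Dvd.dvd.mul_left ?_ _
    refine (hirr.dvd_symm ?_ hdvd)
    obtain ⟨c, rfl⟩ := hdvd
    have hc0 : c ≠ 0 := right_ne_zero_of_mul hm.ne_zero
    have h2 := natDegree_norm_poly (tau_ne_zero hτ) a
    rw [natDegree_mul hirr.ne_zero hc0, h2] at hm2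
    obtain ⟨c₀, rfl⟩ := natDegree_eq_zero.mp (show c.natDegree = 0 by omega)
    have hcu : IsUnit (C c₀) := isUnit_C.mpr (IsUnit.mk0 _ fun h => hc0 (by rw [h, C_0]))
    exact (associated_mul_unit_right _ _ hcu).irreducible hirr

theorem rep_scalar_unit (hτ : Irreducible (X ^ 2 + C τ : k[X])) (hn : 2 ≤ n)
    {a : k} (ha : a ≠ 0) {p : k[X]} {u r : Pt τ n → Matrix (Fin n) (Fin n) k}
    (hr : Rep (C a) X u p) (hur : u * r = 1) (hd : p.natDegree ≤ 2) :
    ∃ c : k, c ≠ 0 ∧ (p = C c ∨ p = C c * (C (a ^ 2) + C τ * X ^ 2)) := by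
  have hirr := irreducible_norm_poly hτ ha
  have key : ∀ q : k[X], q.Monic → Irreducible q → q.natDegree ≤ 2 →
      IsCoprime (C (a ^ 2) + C τ * X ^ 2) q → ¬ q ∣ p := by
    intro q hq hqi hq2 hco
    refine not_dvd_of_rep_unit hn hr hur hq hqi hq2 (isCoprime_C_left ha _)
      (by rwa [← C_pow]) (c := 0) ?_ ?_
    · simpa using ha
    · simpa using ha
  have h0 : p ≠ 0 := by
    rintro rfl
    refine key (X - C 0) (monic_X_sub_C 0) (irreducible_X_sub_C 0) (by simp)
      (isCoprime_X_sub_C ?_) (dvd_zero _)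
    simpa using ha
  by_cases hp : IsUnit p
  · obtain ⟨c, hc, rfl⟩ := isUnit_iff.mp hp
    exact ⟨c, hc.ne_zero, Or.inl rfl⟩
  obtain ⟨q, hq, hqi, hqp, hqd⟩ := exists_monic_irreducible_dvd h0 hp
  rcases hirr.isCoprime_or_dvd q with hc | hdvd
  · exact absurd hqp (key q hq hqi (hqd.trans hd) hc)
  obtain ⟨c, hc⟩ := hdvd.trans hqp
  have hc0 : c ≠ 0 := by
    rintro rfl
    exact h0 (by simpa using hc)
  have h2 := natDegree_norm_poly (tau_ne_zero hτ) a
  have hdc := congrArg natDegree hc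
  rw [natDegree_mul hirr.ne_zero hc0, h2] at hdc
  obtain ⟨c₀, rfl⟩ := natDegree_eq_zero.mp (show c.natDegree = 0 by omega)
  exact ⟨c₀, fun h => hc0 (by rw [h, map_zero]), Or.inr (by rw [hc, mul_comm])⟩

/-! ### The family of proportional components -/

theorem norm_poly_proportional (τ s : k) :
    (X ^ 2 + C τ * (C s * X) ^ 2 : k[X]) = C (1 + τ * s ^ 2) * X ^ 2 := by
  simp only [C_add, C_mul, C_pow, C_1]
  ring

theorem one_add_tau_mul_sq_ne_zero (hτ : Irreducible (X ^ 2 + C τ : k[X])) (s : k) :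
    1 + τ * s ^ 2 ≠ 0 := fun h =>
  one_ne_zero (anisotropic hτ (x := 1) (y := s) (by simpa using h)).1

theorem isCoprime_norm_poly_proportional (hτ : Irreducible (X ^ 2 + C τ : k[X])) (s : k)
    {m : k[X]} (h : IsCoprime X m) :
    IsCoprime (X ^ 2 + C τ * (C s * X) ^ 2 : k[X]) m := by
  rw [norm_poly_proportional]
  exact (isCoprime_mul_unit_left_left
    (isUnit_C.mpr (IsUnit.mk0 _ (one_add_tau_mul_sq_ne_zero hτ s))) _ _).mpr h.pow_left

theorem eq_zero_of_rep_proportional (hτ : Irreducible (X ^ 2 + C τ : k[X]))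
    (hn : 2 ≤ n) (s : k) {h : k[X]} (hd : h.natDegree ≤ 9)
    (hr : Rep X (C s * X) (0 : Pt τ n → Matrix (Fin n) (Fin n) k) h) : h = 0 := by
  refine eq_zero_of_forall_quadratic_dvd hτ hd ?_
  intro m hm hm2 hm0
  have hco : IsCoprime X m := by
    have := (isCoprime_X_sub_C hm0).symm
    rwa [C_0, sub_zero] at this
  refine dvd_of_rep_zero hn hr hm hm2 hco (isCoprime_norm_poly_proportional hτ s hco) (c := 1) ?_ ?_
  · simp
  · simpa using one_add_tau_mul_sq_ne_zero hτ s

theorem rep_proportional_unit (hτ : Irreducible (X ^ 2 + C τ : k[X]))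
    (hn : 2 ≤ n) (s : k) {p : k[X]} {u r : Pt τ n → Matrix (Fin n) (Fin n) k}
    (hr : Rep X (C s * X) u p) (hur : u * r = 1) (hd : p.natDegree ≤ 2) :
    ∃ (c : k) (j : ℕ), p = C c * X ^ j := by
  by_cases h0 : p = 0
  · exact ⟨0, 0, by simp [h0]⟩
  obtain ⟨p', hp', hX⟩ := exists_eq_pow_rootMultiplicity_mul_and_not_dvd p h0 0
  rw [C_0, sub_zero] at hp' hX
  have hp0 : p' ≠ 0 := fun h => h0 (by rw [hp', h, mul_zero])
  by_cases hu : IsUnit p'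
  · obtain ⟨c, -, rfl⟩ := isUnit_iff.mp hu
    exact ⟨c, _, by rw [mul_comm]; exact hp'⟩
  exfalso
  obtain ⟨q, hq, hqi, hqp, -⟩ := exists_monic_irreducible_dvd hp0 hu
  have hqp' : q ∣ p := hp' ▸ Dvd.dvd.mul_left hqp _
  have hco : IsCoprime X q := by
    refine (irreducible_X.isCoprime_or_dvd q).resolve_right fun h => hX (h.trans hqp)
  refine not_dvd_of_rep_unit hn hr hur hq hqi ((natDegree_le_of_dvd hqp' h0).trans hd) hco
    (isCoprime_norm_poly_proportional hτ s hco) (c := 1) ?_ ?_ hqp'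
  · simp
  · simpa using one_add_tau_mul_sq_ne_zero hτ s

/-! ### Spans of registers along the two families -/

/-- The span of the registers that are available before the first counted instruction. -/
def baseSpan (τ : k) (n : ℕ) : Submodule k (Pt τ n → Matrix (Fin n) (Fin n) k) :=
  Submodule.span k {1, fstIn τ n, sndIn τ n}

theorem mem_baseSpan {f : Pt τ n → Matrix (Fin n) (Fin n) k} (hf : f ∈ baseSpan τ n) :
    ∃ c₀ c₁ c₂ : k, f = c₀ • 1 + c₁ • fstIn τ n + c₂ • sndIn τ n := by
  obtain ⟨c₀, c₁, c₂, h⟩ := Submodule.mem_span_triple.mp hf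
  exact ⟨c₀, c₁, c₂, h.symm⟩

theorem rep_base (pA pB : k[X]) (c₀ c₁ c₂ : k) :
    Rep pA pB (c₀ • 1 + c₁ • fstIn τ n + c₂ • sndIn τ n) (C c₀ + C c₁ * pA + C c₂ * pB) := by
  have := ((Rep.one (pA := pA) (pB := pB) (τ := τ) (n := n)).smul c₀).add (Rep.fstIn.smul c₁)
    |>.add (Rep.sndIn.smul c₂)
  rwa [mul_one] at this

theorem mem_sup_span {R : Type*} [Ring R] [Algebra k R] {V : Submodule k R} {r f : R}
    (hf : f ∈ V ⊔ Submodule.span k {r}) : ∃ v ∈ V, ∃ γ : k, f = v + γ • r := by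
  obtain ⟨v, hv, w, hw, rfl⟩ := Submodule.mem_sup.mp hf
  obtain ⟨γ, rfl⟩ := Submodule.mem_span_singleton.mp hw
  exact ⟨v, hv, γ, rfl⟩

/-- Along each family `(a, M)` with a scalar `a ≠ 0`, every member of `V` is a polynomial in `M` of
degree at most `d` whose coefficient of degree `d` does not depend on `a`. -/
def ScalarRep (d : ℕ) (V : Submodule k (Pt τ n → Matrix (Fin n) (Fin n) k)) : Prop :=
  ∀ f ∈ V, ∃ c : k, ∀ a : k, a ≠ 0 →
    ∃ p : k[X], p.natDegree ≤ d ∧ p.coeff d = c ∧ Rep (C a) X f p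

/-- Along each family `(M, s M)` with a scalar `s`, every member of `V` is a polynomial in `M` of
degree at most `d` whose coefficients of degrees `0` and `1` are constant and affine in `s`. -/
def PropRep (d : ℕ) (V : Submodule k (Pt τ n → Matrix (Fin n) (Fin n) k)) : Prop :=
  ∀ f ∈ V, ∃ c₀ c₁ c₂ : k, ∀ s : k,
    ∃ p : k[X], p.natDegree ≤ d ∧ p.coeff 0 = c₀ ∧ p.coeff 1 = c₁ + c₂ * s ∧ Rep X (C s * X) f p

theorem scalarRep_baseSpan : ScalarRep 1 (baseSpan τ n) := by
  intro f hf
  obtain ⟨c₀, c₁, c₂, rfl⟩ := mem_baseSpan hf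
  refine ⟨c₂, fun a _ => ⟨_, ?_, ?_, rep_base _ _ c₀ c₁ c₂⟩⟩
  · rw [← C_mul, ← C_add]
    compute_degree
  · simp [coeff_C]

theorem propRep_baseSpan : PropRep 1 (baseSpan τ n) := by
  intro f hf
  obtain ⟨c₀, c₁, c₂, rfl⟩ := mem_baseSpan hf
  refine ⟨c₀, c₁, c₂, fun s => ⟨_, ?_, ?_, ?_, rep_base _ _ c₀ c₁ c₂⟩⟩
  · compute_degree
  · simp
  · simp [coeff_C]

section Extend

variable {V : Submodule k (Pt τ n → Matrix (Fin n) (Fin n) k)}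
  {u v r : Pt τ n → Matrix (Fin n) (Fin n) k} {d : ℕ}

theorem ScalarRep.sup_mul (h : ScalarRep d V) (hd : 1 ≤ d) (hu : u ∈ V) (hv : v ∈ V) :
    ScalarRep (2 * d) (V ⊔ Submodule.span k {u * v}) := by
  intro f hf
  obtain ⟨w, hw, γ, rfl⟩ := mem_sup_span hf
  obtain ⟨cu, hu⟩ := h u hu
  obtain ⟨cv, hv⟩ := h v hv
  obtain ⟨_, hw⟩ := h w hw
  refine ⟨γ * (cu * cv), fun a ha => ?_⟩
  obtain ⟨pu, hdu, hcu, hru⟩ := hu a ha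
  obtain ⟨pv, hdv, hcv, hrv⟩ := hv a ha
  obtain ⟨pw, hdw, -, hrw⟩ := hw a ha
  have hduv : (pu * pv).natDegree ≤ 2 * d := natDegree_mul_le.trans (by omega)
  refine ⟨_, ?_, ?_, hrw.add ((hru.mul hrv).smul γ)⟩
  · exact (natDegree_add_le _ _).trans
      (max_le (by omega) ((natDegree_C_mul_le _ _).trans hduv))
  · rw [coeff_add, coeff_eq_zero_of_natDegree_lt (by omega), zero_add, coeff_C_mul, two_mul,
      coeff_mul_add_eq_of_natDegree_le hdu hdv, hcu, hcv]

/-- The constant may depend on a; as d ≥ 1, it does not touch the coefficient of degree d. -/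
theorem ScalarRep.sup_const (h : ScalarRep d V) (hd : 1 ≤ d)
    (hr : ∀ a : k, a ≠ 0 → ∃ c : k, Rep (C a) X r (C c)) :
    ScalarRep d (V ⊔ Submodule.span k {r}) := by
  intro f hf
  obtain ⟨w, hw, γ, rfl⟩ := mem_sup_span hf
  obtain ⟨c, hw⟩ := h w hw
  refine ⟨c, fun a ha => ?_⟩
  obtain ⟨pw, hdw, hcw, hrw⟩ := hw a ha
  obtain ⟨e, he⟩ := hr a ha
  refine ⟨_, ?_, ?_, hrw.add (he.smul γ)⟩
  · rw [← C_mul]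
    exact (natDegree_add_le _ _).trans (max_le hdw (by rw [natDegree_C]; omega))
  · rw [← C_mul, coeff_add, coeff_C_of_ne_zero (by omega), add_zero, hcw]

theorem ScalarRep.mono {d' : ℕ} (h : ScalarRep d V) (hd : d < d') : ScalarRep d' V := by
  intro f hf
  obtain ⟨_, hf⟩ := h f hf
  refine ⟨0, fun a ha => ?_⟩
  obtain ⟨p, hp, -, hr⟩ := hf a ha
  exact ⟨p, by omega, coeff_eq_zero_of_natDegree_lt (by omega), hr⟩

theorem PropRep.sup_mul (h : PropRep d V) (hu : u ∈ V) (hv : v ∈ V) :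
    PropRep (2 * d) (V ⊔ Submodule.span k {u * v}) := by
  intro f hf
  obtain ⟨w, hw, γ, rfl⟩ := mem_sup_span hf
  obtain ⟨u₀, u₁, u₂, hu⟩ := h u hu
  obtain ⟨v₀, v₁, v₂, hv⟩ := h v hv
  obtain ⟨w₀, w₁, w₂, hw⟩ := h w hw
  refine ⟨w₀ + γ * (u₀ * v₀), w₁ + γ * (u₀ * v₁ + u₁ * v₀), w₂ + γ * (u₀ * v₂ + u₂ * v₀),
    fun s => ?_⟩
  obtain ⟨pu, hdu, hu0, hu1, hru⟩ := hu s
  obtain ⟨pv, hdv, hv0, hv1, hrv⟩ := hv s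
  obtain ⟨pw, hdw, hw0, hw1, hrw⟩ := hw s
  have hduv : (pu * pv).natDegree ≤ 2 * d := natDegree_mul_le.trans (by omega)
  refine ⟨_, ?_, ?_, ?_, hrw.add ((hru.mul hrv).smul γ)⟩
  · exact (natDegree_add_le _ _).trans
      (max_le (by omega) ((natDegree_C_mul_le _ _).trans hduv))
  · rw [coeff_add, coeff_C_mul, mul_coeff_zero, hu0, hv0, hw0]
  · rw [coeff_add, coeff_C_mul, mul_coeff_one, hu0, hv0, hu1, hv1, hw1]
    ring

theorem Rep.inv_of_const {pA pB : k[X]} {c : k} (hc : c ≠ 0) (hu : Rep pA pB u (C c))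
    (hur : u * r = 1) : Rep pA pB r (C c⁻¹) := by
  intro z M hA hB
  have h1 : u z * r z = 1 := congrFun hur z
  rw [hu z M hA hB, aeval_C, Algebra.algebraMap_eq_smul_one, smul_mul_assoc, one_mul] at h1
  rw [aeval_C, Algebra.algebraMap_eq_smul_one, ← h1, smul_smul, inv_mul_cancel₀ hc, one_smul]

end Extend

/-! ### Inverses taken in the first two steps -/

theorem rep_inv_of_linear (hτ : Irreducible (X ^ 2 + C τ : k[X]))
    (hn : 2 ≤ n) {u r : Pt τ n → Matrix (Fin n) (Fin n) k}
    {V : Submodule k (Pt τ n → Matrix (Fin n) (Fin n) k)}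
    (hV : ScalarRep 1 V) (hu : u ∈ V) (hur : u * r = 1) {a : k} (ha : a ≠ 0) :
    ∃ c : k, Rep (C a) X r (C c) := by
  obtain ⟨_, hu⟩ := hV u hu
  obtain ⟨p, hd, -, hr⟩ := hu a ha
  obtain ⟨c, hc, rfl | rfl⟩ := rep_scalar_unit hτ hn ha hr hur (by omega)
  · exact ⟨_, hr.inv_of_const hc hur⟩
  · rw [natDegree_C_mul hc, natDegree_norm_poly (tau_ne_zero hτ)] at hd
    omega

/-- If the inverse were not constant, the polynomial of u would be a multiple of a² + τx² for the
given a. Then both families together force u to be a multiple of A² + τB² on commuting inputs, and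
this anisotropic form is no product of two linear forms. -/
theorem rep_inv_of_product (hτ : Irreducible (X ^ 2 + C τ : k[X]))
    (hn : 2 ≤ n) {u r : Pt τ n → Matrix (Fin n) (Fin n) k}
    {ℓ₁ ℓ₂ : Pt τ n → Matrix (Fin n) (Fin n) k}
    (h₁ : ℓ₁ ∈ baseSpan τ n) (h₂ : ℓ₂ ∈ baseSpan τ n)
    (hu : u ∈ baseSpan τ n ⊔ Submodule.span k {ℓ₁ * ℓ₂}) (hur : u * r = 1) {a : k} (ha : a ≠ 0) :
    ∃ c : k, Rep (C a) X r (C c) := by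
  have hτ0 := tau_ne_zero hτ
  obtain ⟨ℓ, hℓ, γ, rfl⟩ := mem_sup_span hu
  obtain ⟨a₀, a₁, a₂, rfl⟩ := mem_baseSpan hℓ
  obtain ⟨b₀, b₁, b₂, rfl⟩ := mem_baseSpan h₁
  obtain ⟨d₀, d₁, d₂, rfl⟩ := mem_baseSpan h₂
  clear hu hℓ h₁ h₂
  set u := a₀ • 1 + a₁ • fstIn τ n + a₂ • sndIn τ n +
    γ • ((b₀ • 1 + b₁ • fstIn τ n + b₂ • sndIn τ n) *
      (d₀ • 1 + d₁ • fstIn τ n + d₂ • sndIn τ n))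
  have hrep : ∀ pA pB : k[X], Rep pA pB u _ := fun pA pB =>
    (rep_base (τ := τ) (n := n) pA pB a₀ a₁ a₂).add
      (((rep_base pA pB b₀ b₁ b₂).mul (rep_base pA pB d₀ d₁ d₂)).smul γ)
  have hS : ∀ a : k, Rep (C a) X u (C (γ * b₂ * d₂) * X ^ 2 +
      C (a₂ + γ * ((b₀ + b₁ * a) * d₂ + b₂ * (d₀ + d₁ * a))) * X +
      C (a₀ + a₁ * a + γ * (b₀ + b₁ * a) * (d₀ + d₁ * a))) := by
    intro a
    convert hrep (C a) X using 1
    simp only [C_add, C_mul]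
    ring
  have hP : ∀ s : k, Rep X (C s * X) u (C (γ * (b₁ + b₂ * s) * (d₁ + d₂ * s)) * X ^ 2 +
      C (a₁ + a₂ * s + γ * (b₀ * (d₁ + d₂ * s) + (b₁ + b₂ * s) * d₀)) * X +
      C (a₀ + γ * b₀ * d₀)) := by
    intro s
    convert hrep X (C s * X) using 1
    simp only [C_add, C_mul]
    ring
  by_cases hlead : γ * b₂ * d₂ = 0
  · have hr := hS a
    obtain ⟨c, hc, h | h⟩ := rep_scalar_unit hτ hn ha hr hur natDegree_quadratic_le
    · rw [h] at hr
      exact ⟨_, hr.inv_of_const hc hur⟩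
    · exfalso
      have := congrArg natDegree h
      rw [natDegree_C_mul hc, natDegree_norm_poly hτ0, hlead, C_0, zero_mul, zero_add] at this
      have h' := natDegree_linear_le
        (a := a₂ + γ * ((b₀ + b₁ * a) * d₂ + b₂ * (d₀ + d₁ * a)))
        (b := a₀ + a₁ * a + γ * (b₀ + b₁ * a) * (d₀ + d₁ * a))
      omega
  exfalso
  have hA : ∀ a : k, a ≠ 0 → a₂ + γ * ((b₀ + b₁ * a) * d₂ + b₂ * (d₀ + d₁ * a)) = 0 ∧
      τ * (a₀ + a₁ * a + γ * (b₀ + b₁ * a) * (d₀ + d₁ * a)) = γ * b₂ * d₂ * a ^ 2 := by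
    intro a ha
    obtain ⟨c, hc, h | h⟩ := rep_scalar_unit hτ hn ha (hS a) hur natDegree_quadratic_le
    · exfalso
      have := congrArg natDegree h
      rw [natDegree_quadratic hlead, natDegree_C] at this
      omega
    · have e0 := congrArg (fun p => coeff p 0) h
      have e1 := congrArg (fun p => coeff p 1) h
      have e2 := congrArg (fun p => coeff p 2) h
      simp only [coeff_add, coeff_C_mul, coeff_X_pow, coeff_C, coeff_X] at e0 e1 e2
      norm_num at e0 e1 e2
      refine ⟨e1, ?_⟩
      rw [e0, e2]
      ring
  -- A monomial has at most one nonzero coefficient, so products of two different ones vanish.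
  have hB : ∀ s : k, (a₀ + γ * b₀ * d₀) * (γ * (b₁ + b₂ * s) * (d₁ + d₂ * s)) = 0 ∧
      (a₁ + a₂ * s + γ * (b₀ * (d₁ + d₂ * s) + (b₁ + b₂ * s) * d₀)) *
        (γ * (b₁ + b₂ * s) * (d₁ + d₂ * s)) = 0 := by
    intro s
    obtain ⟨c, j, h⟩ := rep_proportional_unit hτ hn s (hP s) hur natDegree_quadratic_le
    have e0 := congrArg (fun p => coeff p 0) h
    have e1 := congrArg (fun p => coeff p 1) h
    have e2 := congrArg (fun p => coeff p 2) h
    simp only [coeff_add, coeff_C_mul, coeff_X_pow, coeff_C, coeff_X] at e0 e1 e2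
    norm_num at e0 e1 e2
    rw [e0, e1, e2]
    constructor
    · split_ifs <;> first | omega | simp
    · split_ifs <;> first | omega | simp
  obtain ⟨t, ht0, ht1⟩ := exists_ne_zero_ne_one hτ
  have q1 := (hA 1 one_ne_zero).1
  have qt := (hA t ht0).1
  -- From here on `qij` concerns the coefficient of AⁱBʲ in u.
  have q11 : γ * (b₁ * d₂ + b₂ * d₁) = 0 := by
    have : (t - 1) * (γ * (b₁ * d₂ + b₂ * d₁)) = 0 := by linear_combination qt - q1
    exact (mul_eq_zero.mp this).resolve_left (sub_ne_zero.mpr ht1)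
  have q01 : a₂ + γ * (b₀ * d₂ + b₂ * d₀) = 0 := by linear_combination q1 - q11
  have q00 : a₀ + γ * b₀ * d₀ = 0 := by
    have : (a₀ + γ * b₀ * d₀) * (γ * b₂ * d₂) = 0 := by
      linear_combination (hB 1).1 - (hB 0).1 - (a₀ + γ * b₀ * d₀) * q11
    exact (mul_eq_zero.mp this).resolve_right hlead
  have q10 : a₁ + γ * (b₀ * d₁ + b₁ * d₀) = 0 := by
    have : (a₁ + γ * (b₀ * d₁ + b₁ * d₀)) * (γ * b₂ * d₂) = 0 := by
      linear_combination (hB 1).2 - (hB 0).2 - (a₁ + γ * (b₀ * d₁ + b₁ * d₀)) * q11 -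
        (γ * (b₁ + b₂) * (d₁ + d₂)) * q01
    exact (mul_eq_zero.mp this).resolve_right hlead
  have q20 : τ * (γ * b₁ * d₁) = γ * b₂ * d₂ := by
    linear_combination (hA 1 one_ne_zero).2 - τ * q00 - τ * q10
  have hγ : γ ≠ 0 := fun h => hlead (by rw [h]; ring)
  have hd₁ : d₁ ≠ 0 := fun h => hlead (by rw [← q20, h]; ring)
  have hb₁ : b₁ ≠ 0 := fun h => hlead (by rw [← q20, h]; ring)
  have : γ * d₁ * (b₂ ^ 2 + τ * b₁ ^ 2) = 0 := by
    linear_combination b₂ * q11 + b₁ * q20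
  exact hb₁ (anisotropic hτ ((mul_eq_zero.mp this).resolve_left (mul_ne_zero hγ hd₁))).2

/-! ### Outputs are out of reach of a third step -/

theorem not_rep_out_scalar (hτ : Irreducible (X ^ 2 + C τ : k[X]))
    (hn : 2 ≤ n) {α β : k} (hαβ : α ≠ 0 ∨ β ≠ 0) {p : k[X]} (hp : p.natDegree ≤ 4)
    (h : Rep (C 1) X (α • fstOut τ n + β • sndOut τ n) p) : False := by
  have h0 := rep_out_mul Rep.one (by rwa [mul_one] :
    Rep (C 1) X ((α • fstOut τ n + β • sndOut τ n) * 1) p)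
  rw [mul_one, ← C_pow] at h0
  have hl : (C α * C 1 - C β * X : k[X]).natDegree ≤ 1 := by
    rw [← C_mul]; compute_degree
  have hn2 := natDegree_norm_poly (tau_ne_zero hτ) (1 : k)
  have e := eq_zero_of_rep_scalar hτ hn one_ne_zero ((natDegree_sub_le _ _).trans
    (max_le (natDegree_mul_le.trans (by omega)) (by omega))) h0
  have e' : p * (C (1 ^ 2) + C τ * X ^ 2) = C α * C 1 - C β * X := sub_eq_zero.mp e
  have hz : (C α * C 1 - C β * X : k[X]) = 0 := by
    refine eq_zero_of_dvd_of_natDegree_lt (Dvd.intro_left p e') (by omega)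
  have c0 := congrArg (fun p => coeff p 0) hz
  have c1 := congrArg (fun p => coeff p 1) hz
  simp [coeff_C] at c0 c1
  tauto

/-- With Q = a² + τx², clearing denominators in αC + βD = v + γu⁻¹ gives (αa - βx - vQ)u = γQ. Hence
Q divides u and the other factor is the constant αa, so the leading coefficient of u times αa is γτ.
That coefficient does not depend on a, but a does vary. -/
theorem false_of_scalarRep_of_inv (hτ : Irreducible (X ^ 2 + C τ : k[X]))
    (hn : 2 ≤ n) {u r : Pt τ n → Matrix (Fin n) (Fin n) k}
    {V : Submodule k (Pt τ n → Matrix (Fin n) (Fin n) k)}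
    (hV : ScalarRep 2 V) (hu : u ∈ V) (hru : r * u = 1) {α β : k} (hαβ : α ≠ 0 ∨ β ≠ 0)
    (hE : α • fstOut τ n + β • sndOut τ n ∈ V ⊔ Submodule.span k {r}) : False := by
  have hτ0 := tau_ne_zero hτ
  obtain ⟨v, hv, γ, hEv⟩ := mem_sup_span hE
  obtain ⟨cu, hu'⟩ := hV u hu
  obtain ⟨cv, hv'⟩ := hV v hv
  by_cases hγ : γ = 0
  · obtain ⟨p, hd, -, hp⟩ := hv' 1 one_ne_zero
    refine not_rep_out_scalar hτ hn hαβ (show p.natDegree ≤ 4 by omega) ?_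
    rwa [hEv, hγ, zero_smul, add_zero]
  have key : ∀ a : k, a ≠ 0 → α ≠ 0 ∧ cu * (α * a) = γ * τ := by
    intro a ha
    obtain ⟨pu, hdu, hcu, hru'⟩ := hu' a ha
    obtain ⟨pv, hdv, -, hrv⟩ := hv' a ha
    have hirr := irreducible_norm_poly hτ ha
    have hEu : Rep (C a) X ((α • fstOut τ n + β • sndOut τ n) * u) (pv * pu + C γ * 1) := by
      rw [hEv, add_mul, smul_mul_assoc, hru]
      exact (hrv.mul hru').add (Rep.one.smul γ)
    have h0 := rep_out_mul hru' hEu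
    rw [mul_one, ← C_pow] at h0
    have hl : (C α * C a - C β * X : k[X]).natDegree ≤ 1 := by
      rw [← C_mul]; compute_degree
    have hn2 := natDegree_norm_poly hτ0 a
    have hd1 : (pv * pu + C γ).natDegree ≤ 4 := (natDegree_add_le _ _).trans
      (max_le (natDegree_mul_le.trans (by omega)) (by rw [natDegree_C]; omega))
    have e := eq_zero_of_rep_scalar hτ hn ha ((natDegree_sub_le _ _).trans
      (max_le (natDegree_mul_le.trans (by omega)) (natDegree_mul_le.trans (by omega)))) h0
    set Q : k[X] := C (a ^ 2) + C τ * X ^ 2 with hQ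
    have e1 : (C α * C a - C β * X - pv * Q) * pu = C γ * Q := by linear_combination -e
    have hlne : ¬ Q ∣ C α * C a - C β * X := by
      intro hdvd
      have hz := eq_zero_of_dvd_of_natDegree_lt hdvd (by omega)
      have c0 := congrArg (fun p => coeff p 0) hz
      have c1 := congrArg (fun p => coeff p 1) hz
      simp [coeff_C, ha] at c0 c1
      tauto
    have hQu : Q ∣ pu := by
      refine (hirr.prime.dvd_or_dvd (Dvd.intro_left _ e1.symm)).resolve_left fun h => hlne ?_
      have := dvd_add h (Dvd.intro_left pv rfl : Q ∣ pv * Q)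
      rwa [sub_add_cancel] at this
    obtain ⟨q, rfl⟩ := hQu
    have e2 : (C α * C a - C β * X - pv * Q) * q = C γ :=
      mul_left_cancel₀ hirr.ne_zero (by linear_combination e1)
    have hunit : IsUnit ((C α * C a - C β * X - pv * Q) * q) := by
      rw [e2]; exact isUnit_C.mpr (IsUnit.mk0 _ hγ)
    obtain ⟨c, hc, hcq⟩ := isUnit_iff.mp (isUnit_of_mul_isUnit_right hunit)
    obtain ⟨e, he, heq⟩ := isUnit_iff.mp (isUnit_of_mul_isUnit_left hunit)
    have hz : C α * C a - C β * X - C e = 0 := by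
      refine eq_zero_of_dvd_of_natDegree_lt (p := Q) ⟨pv, by rw [heq]; ring⟩ ?_
      have : (C α * C a - C β * X - C e : k[X]).natDegree ≤ 1 := by
        rw [← C_mul]; compute_degree
      omega
    have c0 := congrArg (fun p => coeff p 0) hz
    simp at c0
    rw [← heq, ← hcq, ← C_mul, C_inj] at e2
    have hcu' : cu = τ * c := by
      rw [← hcu, ← hcq, hQ, coeff_mul_C, coeff_add, coeff_C_of_ne_zero two_ne_zero, zero_add,
        coeff_C_mul, coeff_X_pow_self, mul_one]
    have hαa : α * a = e := sub_eq_zero.mp c0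
    refine ⟨fun h => he.ne_zero (by rw [← hαa, h, zero_mul]), ?_⟩
    rw [hcu', hαa, ← e2]
    ring
  obtain ⟨t, ht0, ht1⟩ := exists_ne_zero_ne_one hτ
  obtain ⟨hα, h1⟩ := key 1 one_ne_zero
  obtain ⟨-, h2⟩ := key t ht0
  have hcu : cu ≠ 0 := by
    rintro rfl
    exact mul_ne_zero hγ hτ0 (by rw [← h1, zero_mul])
  have : cu * α * (t - 1) = 0 := by linear_combination h2 - h1
  exact (mul_ne_zero (mul_ne_zero hcu hα) (sub_ne_zero.mpr ht1)) this

theorem rep_out_proportional (hτ : Irreducible (X ^ 2 + C τ : k[X]))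
    (hn : 2 ≤ n) {u : Pt τ n → Matrix (Fin n) (Fin n) k} {α β s : k} {p q : k[X]}
    (hp : p.natDegree ≤ 8)
    (hq : q.natDegree ≤ 8) (hu : Rep X (C s * X) u q)
    (h : Rep X (C s * X) ((α • fstOut τ n + β • sndOut τ n) * u) p) :
    C (1 + τ * s ^ 2) * X * p = C (α - β * s) * q := by
  refine sub_eq_zero.mp (eq_zero_of_rep_proportional hτ hn s ?_ ?_)
  · refine (natDegree_sub_le _ _).trans (max_le (natDegree_mul_le.trans ?_)
      ((natDegree_C_mul_le _ _).trans (by omega)))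
    have : (C (1 + τ * s ^ 2) * X).natDegree ≤ 1 := natDegree_C_mul_le _ _ |>.trans natDegree_X_le
    omega
  · intro z M hA hB
    have h0 := rep_out_mul hu h z M hA hB
    have hX : IsUnit (aeval M (X : k[X])) := by
      rw [← hA]; exact z.2.1
    -- Cancelling the invertible factor M keeps the degree within the bound 9.
    rw [norm_poly_proportional, show p * (C (1 + τ * s ^ 2) * X ^ 2) -
      (C α * X - C β * (C s * X)) * q = X * (C (1 + τ * s ^ 2) * X * p - C (α - β * s) * q) by
        simp only [C_sub, C_mul]; ring, map_mul] at h0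
    exact (hX.mul_right_eq_zero.mp h0.symm).symm

theorem not_propRep_out (hτ : Irreducible (X ^ 2 + C τ : k[X]))
    (hn : 2 ≤ n) {V : Submodule k (Pt τ n → Matrix (Fin n) (Fin n) k)}
    (hV : PropRep 8 V) {α β : k} (hαβ : α ≠ 0 ∨ β ≠ 0)
    (hE : α • fstOut τ n + β • sndOut τ n ∈ V) : False := by
  obtain ⟨_, _, _, h⟩ := hV _ hE
  have key : ∀ s : k, α - β * s = 0 := by
    intro s
    obtain ⟨p, hd, -, -, hp⟩ := h s
    have e := rep_out_proportional hτ hn hd (by simp) Rep.one (by rwa [mul_one])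
    have e0 := congrArg (fun p => coeff p 0) e
    simpa [mul_assoc] using e0.symm
  have h0 := key 0
  have h1 := key 1
  rw [mul_zero, sub_zero] at h0
  rw [h0, zero_sub, mul_one, neg_eq_zero] at h1
  tauto

/-- From αC + βD = v + γu⁻¹ one gets (1 + τs²)x(vu + γ) = (α - βs)u. The coefficients of degrees 0
and 1 give u₀ = 0 and (1 + τs²)γ = (α - βs)(u₁ + u₂s). -/
theorem false_of_propRep_of_inv (hτ : Irreducible (X ^ 2 + C τ : k[X]))
    (hn : 2 ≤ n) {u r : Pt τ n → Matrix (Fin n) (Fin n) k}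
    {V : Submodule k (Pt τ n → Matrix (Fin n) (Fin n) k)}
    (hV : PropRep 4 V) (hu : u ∈ V) (hru : r * u = 1) {α β : k} (hαβ : α ≠ 0 ∨ β ≠ 0)
    (hE : α • fstOut τ n + β • sndOut τ n ∈ V ⊔ Submodule.span k {r}) : False := by
  have hτ0 := tau_ne_zero hτ
  obtain ⟨v, hv, γ, hEv⟩ := mem_sup_span hE
  by_cases hγ : γ = 0
  · refine not_propRep_out hτ hn (V := V) (fun f hf => ?_) hαβ
      (by rwa [hEv, hγ, zero_smul, add_zero])
    obtain ⟨c₀, c₁, c₂, h⟩ := hV f hf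
    refine ⟨c₀, c₁, c₂, fun s => ?_⟩
    obtain ⟨p, hd, h'⟩ := h s
    exact ⟨p, by omega, h'⟩
  obtain ⟨u₀, u₁, u₂, hu'⟩ := hV u hu
  obtain ⟨v₀, _, _, hv'⟩ := hV v hv
  have key : ∀ s : k, (α - β * s) * u₀ = 0 ∧
      (1 + τ * s ^ 2) * (v₀ * u₀ + γ) = (α - β * s) * (u₁ + u₂ * s) := by
    intro s
    obtain ⟨pu, hdu, hu0, hu1, hru'⟩ := hu' s
    obtain ⟨pv, hdv, hv0, -, hrv⟩ := hv' s
    have hEu : Rep X (C s * X) ((α • fstOut τ n + β • sndOut τ n) * u) (pv * pu + C γ * 1) := by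
      rw [hEv, add_mul, smul_mul_assoc, hru]
      exact (hrv.mul hru').add (Rep.one.smul γ)
    rw [mul_one] at hEu
    have e := rep_out_proportional hτ hn ((natDegree_add_le _ _).trans
      (max_le (natDegree_mul_le.trans (by omega)) (by rw [natDegree_C]; omega)))
      (hdu.trans (by norm_num)) hru' hEu
    have e0 := congrArg (fun p => coeff p 0) e
    have e1 := congrArg (fun p => coeff p 1) e
    simp only [mul_assoc, coeff_C_mul, coeff_X_zero, coeff_X_mul, coeff_add, mul_coeff_zero,
      coeff_C_zero, zero_mul, mul_zero, hu0, hv0, hu1] at e0 e1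
    exact ⟨e0.symm, e1⟩
  have hu₀ : u₀ = 0 := by
    by_contra hne
    have h0 := (mul_eq_zero.mp (key 0).1).resolve_right hne
    have h1 := (mul_eq_zero.mp (key 1).1).resolve_right hne
    rw [mul_zero, sub_zero] at h0
    rw [h0, zero_sub, mul_one, neg_eq_zero] at h1
    tauto
  have key' : ∀ s : k, (1 + τ * s ^ 2) * γ = (α - β * s) * (u₁ + u₂ * s) := by
    intro s
    have := (key s).2
    rwa [hu₀, mul_zero, zero_add] at this
  have hβ : β = 0 := by
    by_contra hne
    -- At s = α/β the right side vanishes, but 1 + τs² has no zero in k.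
    have := key' (α / β)
    rw [mul_div_cancel₀ _ hne, sub_self, zero_mul] at this
    exact mul_ne_zero (one_add_tau_mul_sq_ne_zero hτ _) hγ this
  subst hβ
  obtain ⟨t, ht0, ht1⟩ := exists_ne_zero_ne_one hτ
  have h0 := key' 0
  have h1 := key' 1
  have ht := key' t
  -- For β = 0 a quadratic in s equals an affine function; interpolation at 0, 1, t kills its
  -- leading coefficient τγ.
  have : τ * γ * (t * (t - 1)) = 0 := by
    linear_combination ht - t * h1 + (t - 1) * h0
  exact (mul_ne_zero (mul_ne_zero hτ0 hγ) (mul_ne_zero ht0 (sub_ne_zero.mpr ht1))) this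

/-! ### The count of multiplications and inversions -/

theorem false_of_three_steps (hτ : Irreducible (X ^ 2 + C τ : k[X]))
    (hn : 2 ≤ n) {V₁ V₂ V₃ : Submodule k (Pt τ n → Matrix (Fin n) (Fin n) k)}
    (s₁ : Step (baseSpan τ n) V₁) (s₂ : Step V₁ V₂) (s₃ : Step V₂ V₃) {α β : k}
    (hαβ : α ≠ 0 ∨ β ≠ 0) (hE : α • fstOut τ n + β • sndOut τ n ∈ V₃) : False := by
  have scalarCase (h : ScalarRep 2 V₂) : False := by
    obtain ⟨r, rfl, ⟨u, hu, v, hv, rfl⟩ | ⟨u, hu, -, hru⟩⟩ := s₃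
    · obtain ⟨_, h'⟩ := h.sup_mul (by norm_num) hu hv _ hE
      obtain ⟨p, hd, -, hp⟩ := h' 1 one_ne_zero
      exact not_rep_out_scalar hτ hn hαβ hd hp
    · exact false_of_scalarRep_of_inv hτ hn h hu hru hαβ hE
  obtain ⟨r₁, rfl, ⟨u₁, hu₁, v₁, hv₁, rfl⟩ | ⟨u₁, hu₁, hur₁, -⟩⟩ := s₁
  · obtain ⟨r₂, rfl, ⟨u₂, hu₂, v₂, hv₂, rfl⟩ | ⟨u₂, hu₂, hur₂, -⟩⟩ := s₂
    · have h := (propRep_baseSpan.sup_mul hu₁ hv₁).sup_mul hu₂ hv₂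
      obtain ⟨r, rfl, ⟨u, hu, v, hv, rfl⟩ | ⟨u, hu, -, hru⟩⟩ := s₃
      · exact not_propRep_out hτ hn (h.sup_mul hu hv) hαβ hE
      · exact false_of_propRep_of_inv hτ hn h hu hru hαβ hE
    · exact scalarCase ((scalarRep_baseSpan.sup_mul le_rfl hu₁ hv₁).sup_const (by norm_num)
        fun a ha => rep_inv_of_product hτ hn hu₁ hv₁ hu₂ hur₂ ha)
  · have h₁ := scalarRep_baseSpan.sup_const le_rfl
      fun a ha => rep_inv_of_linear hτ hn scalarRep_baseSpan hu₁ hur₁ ha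
    obtain ⟨r₂, rfl, ⟨u₂, hu₂, v₂, hv₂, rfl⟩ | ⟨u₂, hu₂, hur₂, -⟩⟩ := s₂
    · exact scalarCase (h₁.sup_mul le_rfl hu₂ hv₂)
    · exact scalarCase ((h₁.sup_const le_rfl
        fun a ha => rep_inv_of_linear hτ hn h₁ hu₂ hur₂ ha).mono (by norm_num))

theorem five_le_of_computes (hτ : Irreducible (X ^ 2 + C τ : k[X]))
    (hn : 2 ≤ n) {Γ : Program k}
    {a b c d : Pt τ n → Matrix (Fin n) (Fin n) k} (h : Γ.Computes a b c d)
    (ha : a ∈ baseSpan τ n) (hb : b ∈ baseSpan τ n)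
    (hout : ∀ W : Submodule k (Pt τ n → Matrix (Fin n) (Fin n) k), c ∈ W → d ∈ W →
      fstOut τ n ∈ W ∧ sndOut τ n ∈ W) : 5 ≤ Γ.muls + Γ.invs := by
  by_contra hlt
  have h1 : (1 : Pt τ n → Matrix (Fin n) (Fin n) k) ∈ baseSpan τ n :=
    Submodule.subset_span (by simp)
  obtain ⟨t, ht, hc, hd⟩ := h
  obtain ⟨W, hW, htW⟩ := exec_chain Γ.code [a, b] t (baseSpan τ n) h1
    (by simpa using ⟨ha, hb⟩) ht
  obtain ⟨hC, hD⟩ := hout W (htW _ (List.mem_of_getElem? hc)) (htW _ (List.mem_of_getElem? hd))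
  have hle : Γ.code.countP Instr.isMul + Γ.code.countP Instr.isInv ≤ 4 := by
    have : Γ.muls + Γ.invs ≤ 4 := by omega
    exact this
  -- The kind of the fourth step is irrelevant: only the single generator it adds is used.
  obtain ⟨V₁, s₁, V₂, s₂, V₃, s₃, V₄, ⟨r, rfl, -⟩, rfl⟩ := hW.mono h1 hle
  obtain ⟨α, β, hαβ, hE⟩ := exists_linear_combination_mem hC hD
  exact false_of_three_steps hτ hn s₁ s₂ s₃ hαβ hE

theorem five_le_muls_add_invs (hτ : Irreducible (X ^ 2 + C τ : k[X]))
    (hn : 2 ≤ n) {Γ : Program k}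
    (h : Γ.InvertsOn (S₁ τ n) ∨ Γ.InvertsOn (S₂ τ n)) : 5 ≤ Γ.muls + Γ.invs := by
  have hτ0 := tau_ne_zero hτ
  have hA : fstIn τ n ∈ baseSpan τ n := Submodule.subset_span (by simp)
  have hB : sndIn τ n ∈ baseSpan τ n := Submodule.subset_span (by simp)
  rcases h with h | h
  · exact five_le_of_computes hτ hn h.computes₁ hA hB fun W hc hd => ⟨hc, hd⟩
  · refine five_le_of_computes hτ hn (h.computes₂ hτ0) (Submodule.smul_mem _ _ hB) hA
      fun W hc hd => ⟨?_, hc⟩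
    exact (Submodule.smul_mem_iff W (neg_ne_zero.mpr (inv_ne_zero hτ0))).mp hd

end Frobenius

theorem mainTheorem1 {k : Type*} [Field k] (τ : k)
    (hτ : Irreducible (Polynomial.X ^ 2 + Polynomial.C τ : Polynomial k)) (n : ℕ) (hn : 2 ≤ n) :
    -- Frobenius inversion is correct on `S₁ ∪ S₂`, and each branch is correct on its whole domain
    (∀ Z ∈ Frobenius.S₁ τ n ∪ Frobenius.S₂ τ n, (Frobenius.frobeniusInversion τ Z).InvertsAt Z) ∧
    (Frobenius.frobenius₁ τ).InvertsOn (Frobenius.S₁ τ n) ∧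
    (Frobenius.frobenius₂ τ).InvertsOn (Frobenius.S₂ τ n) ∧
    -- on every input it performs two inversions, three multiplications and one addition
    (∀ Z : Matrix (Fin n) (Fin n) (Frobenius.QuadExt τ),
      (Frobenius.frobeniusInversion τ Z).invs = 2 ∧
      (Frobenius.frobeniusInversion τ Z).muls = 3 ∧
      (Frobenius.frobeniusInversion τ Z).adds = 1) ∧
    -- a straight-line program that inverts all of `S₁`, or all of `S₂` (in particular one that
    -- inverts all of `S₁ ∪ S₂`), needs as many multiplications and inversions in total, and as
    -- many additions
    (∀ Γ : Frobenius.Program k,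
      (Γ.InvertsOn (Frobenius.S₁ τ n) ∨ Γ.InvertsOn (Frobenius.S₂ τ n)) →
        5 ≤ Γ.muls + Γ.invs ∧ 1 ≤ Γ.adds) := by
  exact ⟨Frobenius.frobeniusInversion_invertsAt τ n, Frobenius.frobenius₁_invertsOn τ n,
    Frobenius.frobenius₂_invertsOn τ n, Frobenius.frobeniusInversion_cost τ,
    fun _ h => ⟨Frobenius.five_le_muls_add_invs hτ hn h,
      Frobenius.one_le_adds hτ (by omega) h⟩⟩
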